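/- Let $\mathbb{T}^d = \mathbb{R}^d/\mathbb{Z}^d$. For a continuous autonomous vector field $u : \mathbb{T}^d \to \mathbb{R}^d$, a time $T > 0$ and a point $x \in \mathbb{T}^d$, a trajectory of $u$ on $[0,T]$ starting at $x$ is an absolutely continuous curve $\gamma : [0,T] \to \mathbb{T}^d$ with $\gamma(0) = x$ and $\dot\gamma(t) = u(\gamma(t))$ for all $t \in [0,T]$ (one-sided derivatives at the end points). Trajectories on $[0,T]$ from $x$ are not unique if at least two different ones exist. **Theorem.** Let $d \geq 3$ be an integer, and let $1 \leq p < d-1$, $0 < \alpha < 1$ and $T_0 > 0$ be real numbers. There exists an autonomous vector field $u \in W^{1,p}(\mathbb{T}^d, \mathbb{R}^d) \cap C^\alpha(\mathbb{T}^d, \mathbb{R}^d)$ that is divergence-free (in the sense of distributions) such that, for every $T \geq T_0$, the set of initial conditions $x \in \mathbb{T}^d$ from which the trajectories of $u$ on $[0,T]$ are not unique has full Lebesgue measure in $\mathbb{T}^d$. -/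

import Mathlib

open MeasureTheory Set
open scoped NNReal ENNReal ContDiff

noncomputable section

namespace SteadyFlow

/-- The `d`-dimensional torus `ℝ^d / ℤ^d`. Its `volume` is the Lebesgue measure, of total mass one. -/
abbrev Torus (d : ℕ) : Type := UnitAddTorus (Fin d)

/-- The Euclidean space `ℝ^d`. -/
abbrev Space (d : ℕ) : Type := EuclideanSpace ℝ (Fin d)

/-- The quotient map `ℝ^d → ℝ^d / ℤ^d`. -/
def toTorus {d : ℕ} (x : Space d) : Torus d := fun i => ((x i : ℝ) : UnitAddCircle)

/-- `φ ∈ C^∞(𝕋^d)`: the periodic function on `ℝ^d` that corresponds to `φ` is smooth. -/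
def IsSmooth {d : ℕ} (φ : Torus d → ℝ) : Prop :=
  ContDiff ℝ ∞ (fun x : Space d => φ (toTorus x))

/-- The classical partial derivative `∂_i φ` of a function on the torus; it is used for smooth `φ`
only. -/
def partialDeriv {d : ℕ} (i : Fin d) (φ : Torus d → ℝ) (x : Torus d) : ℝ :=
  deriv (fun s : ℝ => φ (x + Pi.single i (s : UnitAddCircle))) 0

/-- `g` is the weak partial derivative `∂_i f` on the torus. -/
def HasWeakPartialDeriv {d : ℕ} (i : Fin d) (f g : Torus d → ℝ) : Prop :=
  Integrable f ∧ Integrable g ∧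
    ∀ φ : Torus d → ℝ, IsSmooth φ →
      ∫ x, f x * partialDeriv i φ x = -∫ x, g x * φ x

/-- `u ∈ W^{1,p}(𝕋^d, ℝ^d)`. -/
def MemSobolev {d : ℕ} (p : ℝ≥0∞) (u : Torus d → Space d) : Prop :=
  MemLp u p ∧
    ∀ i j : Fin d, ∃ g : Torus d → ℝ,
      MemLp g p ∧ HasWeakPartialDeriv j (fun x => u x i) g

/-- `∇ · u = 0` in the sense of distributions on the torus. -/
def IsDivergenceFree {d : ℕ} (u : Torus d → Space d) : Prop :=
  ∀ φ : Torus d → ℝ, IsSmooth φ → ∫ x, ∑ i, u x i * partialDeriv i φ x = 0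

/-- The curve `γ` in the torus has at time `t` the velocity `v ∈ ℝ^d`, relative to the time
interval `S` (one-sided at an end of `S`): some lift of `γ` to `ℝ^d` has the derivative `v`. -/
def HasVelocityWithinAt {d : ℕ} (γ : ℝ → Torus d) (v : Space d) (S : Set ℝ) (t : ℝ) : Prop :=
  ∃ Γ : ℝ → Space d, (∀ s ∈ S, toTorus (Γ s) = γ s) ∧ HasDerivWithinAt Γ v S t

/-- `γ`, restricted to `[0, T]`, is a trajectory of the autonomous vector field `u` that starts
at `x`. The values of `γ` outside `[0, T]` play no role. -/
structure IsTrajectory {d : ℕ} (u : Torus d → Space d) (T : ℝ) (x : Torus d)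
    (γ : ℝ → Torus d) : Prop where
  absolutelyContinuous : AbsolutelyContinuousOnInterval γ 0 T
  velocity : ∀ t ∈ Icc 0 T, HasVelocityWithinAt γ (u (γ t)) (Icc 0 T) t
  start : γ 0 = x

/-- The set of initial conditions from which the trajectories on `[0, T]` are not unique: at least
two different ones start there. -/
def nonuniquenessSet {d : ℕ} (u : Torus d → Space d) (T : ℝ) : Set (Torus d) :=
  {x | ∃ γ₁ γ₂ : ℝ → Torus d, IsTrajectory u T x γ₁ ∧ IsTrajectory u T x γ₂ ∧
    ∃ t ∈ Icc 0 T, γ₁ t ≠ γ₂ t}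

end SteadyFlow

end

/-!
The coordinate `x 0` grows with constant speed and serves as a clock of period one. While it runs
through `[2 ^ (-i - 1), 2 ^ (-i)]`, only the `i`-th generation of the field acts: in every cube of
side `N ^ (-i)` of the remaining `d - 1` coordinates it translates `2 * N ^ (d - 1)` disjoint small
balls, where the balls of one family `b ∈ {0, 1}` are brought close together and the two families
are moved apart. A point at clock time `0` meets the fine generations first. For each `b` there is a
solution that travels with the balls of the family `b` in all generations, the balls being
prescribed by the base `N` digits of the point; both solutions start in the point, and at clock
time `1` their coordinates differ by `1 / 2`. Away from the clock time `0` the field is Lipschitz,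
so that every point can first be carried to an integral clock time.

The `i`-th generation has amplitude `(2 / N) ^ i` and slope `(2 / (N * η)) ^ i`, up to constants,
and its derivatives live on a set of volume `(η * N) ^ (i * (d - 1))`. The series of the derivatives
converges in `L ^ p` if `2 ^ p * ε ^ (d - 1 - p) < 1` with `ε = η * N`, which is possible because
`p < d - 1`; interpolation between amplitude and slope gives the Hölder bound for large `N`.
-/

noncomputable section

namespace SteadyFlow

section General

lemma integrable_tsum {X ι : Type*} [MeasurableSpace X] {μ : Measure X} [Countable ι]
    {f : ι → X → ℝ} (hf : ∀ i, Integrable (f i) μ) (hs : Summable fun i => ∫ x, ‖f i x‖ ∂μ) :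
    Integrable (fun x => ∑' i, f i x) μ := by
  refine ⟨(AEMeasurable.tsum fun i => (hf i).1.aemeasurable).aestronglyMeasurable, ?_⟩
  calc ∫⁻ x, ‖∑' i, f i x‖ₑ ∂μ ≤ ∫⁻ x, ∑' i, ‖f i x‖ₑ ∂μ :=
        lintegral_mono fun x => enorm_tsum_le_tsum_enorm
    _ = ∑' i, ENNReal.ofReal (∫ x, ‖f i x‖ ∂μ) := by
        rw [lintegral_tsum fun i => (hf i).1.enorm]
        simp only [ofReal_integral_norm_eq_lintegral_enorm (hf _)]
    _ < ⊤ := by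
        rw [← ENNReal.ofReal_tsum_of_nonneg (fun i => integral_nonneg fun x => norm_nonneg _) hs]
        exact ENNReal.ofReal_lt_top

lemma exists_hasSum_apply_of_disjoint_support {X ι M : Type*} [Nonempty ι] [AddCommMonoid M]
    [TopologicalSpace M] {f : ι → X → M}
    (hf : Pairwise (Function.onFun Disjoint fun i => Function.support (f i))) (x : X) :
    ∃ k, HasSum (fun i => f i x) (f k x) := by
  by_cases hx : ∃ k, x ∈ Function.support (f k)
  · obtain ⟨k, hk⟩ := hx
    exact ⟨k, hasSum_single k fun i hi =>
      Function.notMem_support.1 fun hi' => Set.disjoint_left.1 (hf hi) hi' hk⟩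
  · simp only [Function.mem_support, not_exists, not_not] at hx
    exact ⟨Classical.arbitrary ι, by simp only [hx, hasSum_zero]⟩

lemma memLp_tsum_of_disjoint_support {X ι : Type*} [MeasurableSpace X] {μ : Measure X}
    [Countable ι] [Nonempty ι] {f : ι → X → ℝ} (hf : ∀ i, Measurable (f i))
    (hdisj : Pairwise (Function.onFun Disjoint fun i => Function.support (f i)))
    {p : ℝ} (hp : 0 < p) (hs : ∑' i, ∫⁻ x, ‖f i x‖ₑ ^ p ∂μ < ⊤) :
    MemLp (fun x => ∑' i, f i x) (ENNReal.ofReal p) μ := by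
  refine ⟨(Measurable.tsum hf).aestronglyMeasurable, ?_⟩
  rw [eLpNorm_lt_top_iff_lintegral_rpow_enorm_lt_top (by simpa using hp) ENNReal.ofReal_ne_top,
    ENNReal.toReal_ofReal hp.le]
  refine lt_of_le_of_lt ?_ hs
  rw [← lintegral_tsum fun i => ((hf i).enorm.pow_const p).aemeasurable]
  refine lintegral_mono fun x => ?_
  obtain ⟨k, hk⟩ := exists_hasSum_apply_of_disjoint_support hdisj x
  simp only [hk.tsum_eq]
  exact ENNReal.le_tsum (f := fun i => ‖f i x‖ₑ ^ p) k

lemma memHolder_of_dist_le {X Y : Type*} [PseudoMetricSpace X] [PseudoMetricSpace Y]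
    {f : X → Y} {α : ℝ≥0} {K : ℝ} (h : ∀ x y, dist (f x) (f y) ≤ K * dist x y ^ (α : ℝ)) :
    MemHolder α f := by
  refine ⟨K.toNNReal, fun x y => ?_⟩
  rw [edist_dist, edist_dist, ENNReal.ofReal_rpow_of_nonneg dist_nonneg α.coe_nonneg,
    ← ENNReal.ofReal_coe_nnreal, ← ENNReal.ofReal_mul (NNReal.coe_nonneg _)]
  refine ENNReal.ofReal_le_ofReal ((h x y).trans ?_)
  gcongr
  exact Real.le_coe_toNNReal K

lemma norm_le_sum_abs {ι : Type*} [Fintype ι] (v : EuclideanSpace ℝ ι) : ‖v‖ ≤ ∑ j, |v j| := by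
  rw [EuclideanSpace.norm_eq]
  refine Real.sqrt_le_iff.2 ⟨Finset.sum_nonneg fun j _ => abs_nonneg _, ?_⟩
  exact Finset.sum_sq_le_sq_sum_of_nonneg fun j _ => norm_nonneg (v j)

lemma memHolder_of_forall_apply {X ι : Type*} [MetricSpace X] [Fintype ι]
    {u : X → EuclideanSpace ℝ ι} {α : ℝ≥0} (h : ∀ j, MemHolder α fun x => u x j) :
    MemHolder α u := by
  refine memHolder_of_dist_le (K := ∑ j, (nnHolderNorm α fun x => u x j : ℝ)) fun x y => ?_
  rw [dist_eq_norm, Finset.sum_mul]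
  exact (norm_le_sum_abs _).trans (Finset.sum_le_sum fun j _ => (h j).holderWith.dist_le x y)

end General

section Torus

variable {d : ℕ}

lemma coe_intCast_unitAddCircle (k : ℤ) : ((k : ℝ) : UnitAddCircle) = 0 :=
  (AddCircle.coe_eq_zero_iff 1).2 ⟨k, by simp⟩

lemma exists_coe_eq_and_abs_eq_norm (a : UnitAddCircle) : ∃ r : ℝ, (r : UnitAddCircle) = a ∧
    |r| = ‖a‖ := by
  obtain ⟨r, rfl⟩ := QuotientAddGroup.mk_surjective a
  refine ⟨r - round r, ?_, UnitAddCircle.norm_eq.symm⟩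
  rw [AddCircle.coe_sub, coe_intCast_unitAddCircle, sub_zero]

lemma single_coe_add (j : Fin d) (s t : ℝ) :
    (Pi.single j ((s + t : ℝ) : UnitAddCircle) : Torus d)
      = Pi.single j (s : UnitAddCircle) + Pi.single j (t : UnitAddCircle) := by
  rw [AddCircle.coe_add, Pi.single_add]

lemma isOpenQuotientMap_toTorus : IsOpenQuotientMap (toTorus : Space d → Torus d) :=
  (IsOpenQuotientMap.piMap fun _ : Fin d => QuotientAddGroup.isOpenQuotientMap_mk
    (N := AddSubgroup.zmultiples (1 : ℝ))).comp
      (EuclideanSpace.equiv (Fin d) ℝ).toHomeomorph.isOpenQuotientMap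

lemma toTorus_add (x y : Space d) : toTorus (x + y) = toTorus x + toTorus y := rfl

lemma toTorus_single (j : Fin d) (s : ℝ) :
    toTorus (EuclideanSpace.single j s) = Pi.single j (s : UnitAddCircle) := by
  ext i
  rcases eq_or_ne i j with rfl | h
  · simp [toTorus]
  · simp [toTorus, h]

lemma lipschitzWith_toTorus : LipschitzWith 1 (toTorus : Space d → Torus d) := by
  refine LipschitzWith.of_dist_le_mul fun x y => ?_
  rw [NNReal.coe_one, one_mul, dist_pi_le_iff dist_nonneg, dist_eq_norm x y]
  intro i
  calc dist (toTorus x i) (toTorus y i) = ‖((x i - y i : ℝ) : UnitAddCircle)‖ := by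
        rw [dist_eq_norm, AddCircle.coe_sub]; rfl
    _ ≤ |x i - y i| := by
        rw [UnitAddCircle.norm_eq]
        simpa using round_le (x i - y i) 0
    _ ≤ ‖x - y‖ := PiLp.norm_apply_le (x - y) i

lemma integrable_of_continuous {f : Torus d → ℝ} (hf : Continuous f) : Integrable f :=
  hf.integrable_of_hasCompactSupport (HasCompactSupport.of_compactSpace f)

lemma exists_abs_le_of_continuous {X : Type*} [TopologicalSpace X] [CompactSpace X] {f : X → ℝ}
    (hf : Continuous f) : ∃ K, ∀ x, |f x| ≤ K :=
  (isCompact_range hf).isBounded.exists_norm_le.imp fun _ h x => h _ ⟨x, rfl⟩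

lemma integrable_mul_of_continuous {f ψ : Torus d → ℝ} (hf : Integrable f) (hψ : Continuous ψ) :
    Integrable fun x => f x * ψ x := by
  obtain ⟨K, hK⟩ := exists_abs_le_of_continuous hψ
  exact hf.mul_bdd hψ.aestronglyMeasurable (Filter.Eventually.of_forall hK)

lemma hasSum_integral_mul {ι : Type*} [Countable ι] {f : ι → Torus d → ℝ}
    (hf : ∀ i, Integrable (f i)) (hs : Summable fun i => ∫ x, ‖f i x‖) {ψ : Torus d → ℝ}
    (hψ : Continuous ψ) :
    HasSum (fun i => ∫ x, f i x * ψ x) (∫ x, (∑' i, f i x) * ψ x) := by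
  obtain ⟨K, hK⟩ := exists_abs_le_of_continuous hψ
  simp only [← tsum_mul_right]
  refine hasSum_integral_of_summable_integral_norm
    (fun i => integrable_mul_of_continuous (hf i) hψ) ?_
  refine Summable.of_nonneg_of_le (fun i => integral_nonneg fun x => norm_nonneg _) (fun i => ?_)
    (hs.mul_right K)
  rw [← integral_mul_const]
  refine integral_mono (integrable_mul_of_continuous (hf i) hψ).norm ((hf i).norm.mul_const K)
    fun x => ?_
  rw [norm_mul]
  exact mul_le_mul_of_nonneg_left (hK x) (norm_nonneg _)

end Torus

/-! ### Classical and weak partial derivatives on the torus -/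

/-- `g` is the classical partial derivative `∂_j f` of `f` at every point of the torus; in contrast
to `partialDeriv` it asserts that the derivative exists. -/
def HasPartialDeriv {d : ℕ} (j : Fin d) (f g : Torus d → ℝ) : Prop :=
  ∀ x, HasDerivAt (fun s : ℝ => f (x + Pi.single j (s : UnitAddCircle))) (g x) 0

section PartialDeriv

variable {d : ℕ} {j : Fin d} {f g f' g' : Torus d → ℝ}

namespace HasPartialDeriv

lemma hasDerivAt (h : HasPartialDeriv j f g) (x : Torus d) (s : ℝ) :
    HasDerivAt (fun s : ℝ => f (x + Pi.single j (s : UnitAddCircle)))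
      (g (x + Pi.single j (s : UnitAddCircle))) s := by
  have := HasDerivAt.comp_sub_const s s
    (f := fun r : ℝ => f (x + Pi.single j (s : UnitAddCircle) + Pi.single j (r : UnitAddCircle)))
    (by simpa using h (x + Pi.single j (s : UnitAddCircle)))
  simpa only [add_assoc, ← single_coe_add, add_sub_cancel] using this

lemma const_mul (c : ℝ) (hf : HasPartialDeriv j f f') :
    HasPartialDeriv j (fun x => c * f x) (fun x => c * f' x) :=
  fun x => (hf x).const_mul c

lemma mul (hf : HasPartialDeriv j f f') (hg : HasPartialDeriv j g g') :
    HasPartialDeriv j (fun x => f x * g x) (fun x => f' x * g x + f x * g' x) := by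
  intro x
  simpa using (hf x).fun_mul (hg x)

lemma sum {ι : Type*} {s : Finset ι} {F F' : ι → Torus d → ℝ}
    (h : ∀ i ∈ s, HasPartialDeriv j (F i) (F' i)) :
    HasPartialDeriv j (fun x => ∑ i ∈ s, F i x) (fun x => ∑ i ∈ s, F' i x) :=
  fun x => HasDerivAt.fun_sum fun i hi => h i hi x

lemma prod {ι : Type*} [DecidableEq ι] {s : Finset ι} {F F' : ι → Torus d → ℝ}
    (h : ∀ i ∈ s, HasPartialDeriv j (F i) (F' i)) :
    HasPartialDeriv j (fun x => ∏ i ∈ s, F i x)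
      (fun x => ∑ i ∈ s, (∏ k ∈ s.erase i, F k x) * F' i x) := by
  intro x
  simpa using HasDerivAt.fun_finsetProd fun i hi => h i hi x

-- By translation invariance, `∫ f (x + s e_j)` does not depend on `s`; differentiate at `s = 0`.
lemma integral_eq_zero (h : HasPartialDeriv j f g) (hf : Continuous f) (hg : Continuous g) :
    ∫ x, g x = 0 := by
  obtain ⟨C, hC⟩ := exists_abs_le_of_continuous hg
  have hF : ∀ s : ℝ, Continuous fun x : Torus d => f (x + Pi.single j (s : UnitAddCircle)) := by
    intro s; fun_prop
  have hF' : Continuous fun x : Torus d => g (x + Pi.single j ((0 : ℝ) : UnitAddCircle)) := by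
    fun_prop
  have key := (hasDerivAt_integral_of_dominated_loc_of_deriv_le
    (μ := (volume : Measure (Torus d)))
    (F := fun (s : ℝ) x => f (x + Pi.single j (s : UnitAddCircle)))
    (F' := fun (s : ℝ) x => g (x + Pi.single j (s : UnitAddCircle)))
    (bound := fun _ => C) (x₀ := (0 : ℝ)) (s := univ) Filter.univ_mem
    (Filter.Eventually.of_forall fun s => (hF s).aestronglyMeasurable)
    (integrable_of_continuous (hF 0)) hF'.aestronglyMeasurable
    (Filter.Eventually.of_forall fun x s _ => hC _) (integrable_const C)
    (Filter.Eventually.of_forall fun x s _ => h.hasDerivAt x s)).2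
  simp only [integral_add_right_eq_self (μ := (volume : Measure (Torus d))) f] at key
  simpa using key.unique (hasDerivAt_const _ _)

lemma integral_mul (hf : HasPartialDeriv j f f') (hg : HasPartialDeriv j g g')
    (cf : Continuous f) (cf' : Continuous f') (cg : Continuous g) (cg' : Continuous g') :
    ∫ x, f x * g' x = -∫ x, f' x * g x := by
  have h := (hf.mul hg).integral_eq_zero (by fun_prop) (by fun_prop)
  rw [integral_add (integrable_of_continuous (by fun_prop))
    (integrable_of_continuous (by fun_prop))] at h
  linarith

lemma abs_add_single_sub_le (h : HasPartialDeriv j f f') {L : ℝ} (hL : ∀ x, |f' x| ≤ L)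
    (x : Torus d) (a : UnitAddCircle) : |f (x + Pi.single j a) - f x| ≤ L * ‖a‖ := by
  obtain ⟨r, rfl, hr⟩ := exists_coe_eq_and_abs_eq_norm a
  rw [← hr]
  simpa using Convex.norm_image_sub_le_of_norm_hasDerivWithin_le (s := univ) (x := 0) (y := r)
    (fun s _ => (h.hasDerivAt x s).hasDerivWithinAt) (fun s _ => hL _) convex_univ
    (mem_univ _) (mem_univ _)

end HasPartialDeriv

-- The coordinates of `y` are replaced by those of `x` one at a time.
lemma abs_sub_le_of_hasPartialDeriv {F' : Fin d → Torus d → ℝ} {L : ℝ}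
    (hf : ∀ j, HasPartialDeriv j f (F' j)) (hL : ∀ j x, |F' j x| ≤ L) (x y : Torus d) :
    |f x - f y| ≤ d * L * dist x y := by
  suffices main : ∀ S : Finset (Fin d), |f (S.piecewise x y) - f y| ≤ S.card * L * dist x y by
    simpa using main Finset.univ
  intro S
  induction S using Finset.induction_on with
  | empty => simp
  | insert j S hj ih =>
    have hL₀ : 0 ≤ L := (abs_nonneg _).trans (hL j x)
    have hxy : (insert j S).piecewise x y = S.piecewise x y + Pi.single j (x j - y j) := by
      ext m
      rcases eq_or_ne m j with rfl | hm
      · simp [hj]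
      · simp [Finset.piecewise, hm]
    rw [Finset.card_insert_of_notMem hj, Nat.cast_succ]
    calc |f ((insert j S).piecewise x y) - f y|
        ≤ |f (S.piecewise x y + Pi.single j (x j - y j)) - f (S.piecewise x y)|
          + |f (S.piecewise x y) - f y| := hxy ▸ abs_sub_le _ _ _
      _ ≤ L * dist x y + S.card * L * dist x y := by
          gcongr
          refine ((hf j).abs_add_single_sub_le (hL j) _ _).trans ?_
          gcongr
          exact (dist_eq_norm (x j) (y j)).symm.trans_le (dist_le_pi_dist x y j)
      _ = (S.card + 1) * L * dist x y := by ring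

namespace IsSmooth

variable {φ : Torus d → ℝ}

lemma continuous (h : IsSmooth φ) : Continuous φ :=
  isOpenQuotientMap_toTorus.isQuotientMap.continuous_iff.2 (ContDiff.continuous h)

lemma hasDerivAt_single (h : IsSmooth φ) (j : Fin d) (x : Space d) :
    HasDerivAt (fun s : ℝ => φ (toTorus x + Pi.single j (s : UnitAddCircle)))
      (fderiv ℝ (fun x : Space d => φ (toTorus x)) x (EuclideanSpace.single j 1)) 0 := by
  have hφ : HasFDerivAt (fun x : Space d => φ (toTorus x)) _ x :=
    (ContDiff.differentiable h (by simp)).differentiableAt.hasFDerivAt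
  have hline := hφ.hasLineDerivAt (EuclideanSpace.single j (1 : ℝ))
  have hsingle : ∀ s : ℝ,
      s • (EuclideanSpace.single j (1 : ℝ) : Space d) = EuclideanSpace.single j s := by
    intro s
    ext i
    simp [PiLp.single_apply]
  simpa only [HasLineDerivAt, hsingle, toTorus_add, toTorus_single] using hline

lemma hasPartialDeriv (h : IsSmooth φ) (j : Fin d) : HasPartialDeriv j φ (partialDeriv j φ) := by
  intro x
  obtain ⟨x, rfl⟩ := isOpenQuotientMap_toTorus.surjective x
  exact (h.hasDerivAt_single j x).differentiableAt.hasDerivAt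

lemma continuous_partialDeriv (h : IsSmooth φ) (j : Fin d) : Continuous (partialDeriv j φ) := by
  rw [isOpenQuotientMap_toTorus.isQuotientMap.continuous_iff]
  have hderiv : partialDeriv j φ ∘ toTorus = fun x =>
      fderiv ℝ (fun x : Space d => φ (toTorus x)) x (EuclideanSpace.single j 1) :=
    funext fun x => (h.hasDerivAt_single j x).deriv
  rw [hderiv]
  exact (ContDiff.continuous_fderiv h (by simp)).clm_apply continuous_const

end IsSmooth

lemma HasPartialDeriv.hasWeakPartialDeriv (h : HasPartialDeriv j f f') (hf : Continuous f)
    (hf' : Continuous f') : HasWeakPartialDeriv j f f' :=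
  ⟨integrable_of_continuous hf, integrable_of_continuous hf', fun _ hφ =>
    h.integral_mul (hφ.hasPartialDeriv j) hf hf' hφ.continuous (hφ.continuous_partialDeriv j)⟩

namespace HasWeakPartialDeriv

lemma const_add (h : HasWeakPartialDeriv j f g) (c : ℝ) :
    HasWeakPartialDeriv j (fun x => c + f x) g := by
  refine ⟨(integrable_const c).add h.1, h.2.1, fun φ hφ => ?_⟩
  have hφ' := hφ.continuous_partialDeriv j
  simp only [add_mul]
  rw [integral_add ((integrable_of_continuous hφ').const_mul c)
    (integrable_mul_of_continuous h.1 hφ'), integral_const_mul,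
    (hφ.hasPartialDeriv j).integral_eq_zero hφ.continuous hφ', mul_zero, zero_add, h.2.2 φ hφ]

lemma const_mul (h : HasWeakPartialDeriv j f g) (c : ℝ) :
    HasWeakPartialDeriv j (fun x => c * f x) (fun x => c * g x) := by
  refine ⟨h.1.const_mul c, h.2.1.const_mul c, fun φ hφ => ?_⟩
  simp only [mul_assoc, integral_const_mul]
  rw [h.2.2 φ hφ, mul_neg]

lemma tsum {ι : Type*} [Countable ι] {f g : ι → Torus d → ℝ}
    (h : ∀ i, HasWeakPartialDeriv j (f i) (g i)) (hf : Summable fun i => ∫ x, ‖f i x‖)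
    (hg : Summable fun i => ∫ x, ‖g i x‖) :
    HasWeakPartialDeriv j (fun x => ∑' i, f i x) (fun x => ∑' i, g i x) := by
  refine ⟨integrable_tsum (fun i => (h i).1) hf, integrable_tsum (fun i => (h i).2.1) hg,
    fun φ hφ => ?_⟩
  rw [← (hasSum_integral_mul (fun i => (h i).1) hf (hφ.continuous_partialDeriv j)).tsum_eq,
    ← (hasSum_integral_mul (fun i => (h i).2.1) hg hφ.continuous).tsum_eq, ← tsum_neg]
  exact tsum_congr fun i => (h i).2.2 φ hφ

end HasWeakPartialDeriv

lemma isDivergenceFree_of_hasWeakPartialDeriv {u : Torus d → Space d} {G : Fin d → Torus d → ℝ}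
    (h : ∀ j, HasWeakPartialDeriv j (fun x => u x j) (G j)) (hG : ∀ x, ∑ j, G j x = 0) :
    IsDivergenceFree u := by
  intro φ hφ
  rw [integral_finsetSum _ fun j _ =>
      integrable_mul_of_continuous (h j).1 (hφ.continuous_partialDeriv j),
    Finset.sum_congr rfl fun j _ => (h j).2.2 φ hφ, Finset.sum_neg_distrib,
    ← integral_finsetSum _ fun j _ => integrable_mul_of_continuous (h j).2.1 hφ.continuous]
  simp [← Finset.sum_mul, hG]

end PartialDeriv

/-! ### Series of localized functions -/

/-- `F` is a `C¹` function with the partial derivatives `F' j`; the amplitude `A` bounds `F`, the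
slope `L` bounds its derivatives, and the derivatives vanish outside `S`. -/
structure IsLocalized {d : ℕ} (F : Torus d → ℝ) (F' : Fin d → Torus d → ℝ) (A L : ℝ)
    (S : Set (Torus d)) : Prop where
  continuous : Continuous F
  continuous_deriv : ∀ j, Continuous (F' j)
  hasPartialDeriv : ∀ j, HasPartialDeriv j F (F' j)
  abs_le : ∀ x, |F x| ≤ A
  abs_deriv_le : ∀ j x, |F' j x| ≤ L
  deriv_eq_zero : ∀ j, ∀ x ∉ S, F' j x = 0

namespace IsLocalized

variable {d : ℕ} {F : Torus d → ℝ} {F' : Fin d → Torus d → ℝ} {A L : ℝ} {S : Set (Torus d)}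

lemma mono (h : IsLocalized F F' A L S) {A₁ L₁ : ℝ} {S₁ : Set (Torus d)} (hA : A ≤ A₁)
    (hL : L ≤ L₁) (hS : S ⊆ S₁) : IsLocalized F F' A₁ L₁ S₁ where
  continuous := h.continuous
  continuous_deriv := h.continuous_deriv
  hasPartialDeriv := h.hasPartialDeriv
  abs_le x := (h.abs_le x).trans hA
  abs_deriv_le j x := (h.abs_deriv_le j x).trans hL
  deriv_eq_zero j x hx := h.deriv_eq_zero j x fun hx' => hx (hS hx')

lemma const_mul (h : IsLocalized F F' A L S) (c : ℝ) :
    IsLocalized (fun x => c * F x) (fun j x => c * F' j x) (|c| * A) (|c| * L) S where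
  continuous := h.continuous.const_mul c
  continuous_deriv j := (h.continuous_deriv j).const_mul c
  hasPartialDeriv j := (h.hasPartialDeriv j).const_mul c
  abs_le x := by
    rw [abs_mul]
    exact mul_le_mul_of_nonneg_left (h.abs_le x) (abs_nonneg c)
  abs_deriv_le j x := by
    rw [abs_mul]
    exact mul_le_mul_of_nonneg_left (h.abs_deriv_le j x) (abs_nonneg c)
  deriv_eq_zero j x hx := by rw [h.deriv_eq_zero j x hx, mul_zero]

lemma add (h : IsLocalized F F' A L S) {G : Torus d → ℝ} {G' : Fin d → Torus d → ℝ} {B M : ℝ}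
    (h' : IsLocalized G G' B M S) :
    IsLocalized (fun x => F x + G x) (fun j x => F' j x + G' j x) (A + B) (L + M) S where
  continuous := h.continuous.add h'.continuous
  continuous_deriv j := (h.continuous_deriv j).add (h'.continuous_deriv j)
  hasPartialDeriv j x := (h.hasPartialDeriv j x).add (h'.hasPartialDeriv j x)
  abs_le x := (abs_add_le _ _).trans (add_le_add (h.abs_le x) (h'.abs_le x))
  abs_deriv_le j x := (abs_add_le _ _).trans (add_le_add (h.abs_deriv_le j x) (h'.abs_deriv_le j x))
  deriv_eq_zero j x hx := by rw [h.deriv_eq_zero j x hx, h'.deriv_eq_zero j x hx, add_zero]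

lemma sum {ι : Type*} {s : Finset ι} {F : ι → Torus d → ℝ} {F' : ι → Fin d → Torus d → ℝ}
    {A L : ι → ℝ} (h : ∀ i ∈ s, IsLocalized (F i) (F' i) (A i) (L i) S) :
    IsLocalized (fun x => ∑ i ∈ s, F i x) (fun j x => ∑ i ∈ s, F' i j x)
      (∑ i ∈ s, A i) (∑ i ∈ s, L i) S where
  continuous := continuous_finsetSum _ fun i hi => (h i hi).continuous
  continuous_deriv j := continuous_finsetSum _ fun i hi => (h i hi).continuous_deriv j
  hasPartialDeriv j := HasPartialDeriv.sum fun i hi => (h i hi).hasPartialDeriv j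
  abs_le x := (Finset.abs_sum_le_sum_abs _ _).trans
    (Finset.sum_le_sum fun i hi => (h i hi).abs_le x)
  abs_deriv_le j x := (Finset.abs_sum_le_sum_abs _ _).trans
    (Finset.sum_le_sum fun i hi => (h i hi).abs_deriv_le j x)
  deriv_eq_zero j x hx := Finset.sum_eq_zero fun i hi => (h i hi).deriv_eq_zero j x hx

lemma amplitude_nonneg (h : IsLocalized F F' A L S) : 0 ≤ A := (abs_nonneg _).trans (h.abs_le 0)

lemma memHolder_one (h : IsLocalized F F' A L S) : MemHolder 1 F :=
  memHolder_of_dist_le (K := d * L) fun x y => by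
    simpa [Real.dist_eq] using abs_sub_le_of_hasPartialDeriv h.hasPartialDeriv h.abs_deriv_le x y

lemma hasWeakPartialDeriv (h : IsLocalized F F' A L S) (j : Fin d) :
    HasWeakPartialDeriv j F (F' j) :=
  (h.hasPartialDeriv j).hasWeakPartialDeriv h.continuous (h.continuous_deriv j)

lemma abs_sub_le_rpow (h : IsLocalized F F' A L S) (hL : 0 ≤ L) {α : ℝ} (hα₀ : 0 ≤ α)
    (hα₁ : α ≤ 1) (x y : Torus d) :
    |F x - F y| ≤ (2 * A) ^ (1 - α) * (d * L) ^ α * dist x y ^ α := by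
  have hbdd : |F x - F y| ≤ 2 * A := by
    linarith [abs_sub (F x) (F y), h.abs_le x, h.abs_le y]
  have hlip : |F x - F y| ≤ d * L * dist x y :=
    abs_sub_le_of_hasPartialDeriv h.hasPartialDeriv h.abs_deriv_le x y
  calc |F x - F y| = |F x - F y| ^ (1 - α) * |F x - F y| ^ α := by
        rw [← Real.rpow_add_of_nonneg (abs_nonneg _) (by linarith) hα₀, sub_add_cancel,
          Real.rpow_one]
    _ ≤ (2 * A) ^ (1 - α) * (d * L * dist x y) ^ α := by
        have := h.amplitude_nonneg
        gcongr
    _ = (2 * A) ^ (1 - α) * (d * L) ^ α * dist x y ^ α := by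
        rw [Real.mul_rpow (by positivity) dist_nonneg, mul_assoc]

lemma lintegral_rpow_le (h : IsLocalized F F' A L S) (j : Fin d) {p : ℝ} (hp : 0 < p) :
    ∫⁻ x, ‖F' j x‖ₑ ^ p ≤ ENNReal.ofReal L ^ p * volume S := by
  have hsupp : (fun x => ‖F' j x‖ₑ ^ p).support ⊆ S := fun x hx => by
    by_contra hxS
    exact hx (by simp [h.deriv_eq_zero j x hxS, hp])
  calc ∫⁻ x, ‖F' j x‖ₑ ^ p = ∫⁻ x in S, ‖F' j x‖ₑ ^ p :=
        (setLIntegral_eq_of_support_subset hsupp).symm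
    _ ≤ ∫⁻ _ in S, ENNReal.ofReal L ^ p := by
        refine lintegral_mono fun x => ?_
        rw [Real.enorm_eq_ofReal_abs]
        gcongr
        exact h.abs_deriv_le j x
    _ = ENNReal.ofReal L ^ p * volume S := setLIntegral_const _ _

end IsLocalized

/-- A sequence of localized functions with disjoint supports whose amplitudes, slopes and support
volumes are `O(a ^ i)`, `O(l ^ i)` and `O(r ^ i)`. -/
structure IsGeometric {d : ℕ} (F : ℕ → Torus d → ℝ) (F' : ℕ → Fin d → Torus d → ℝ)
    (S : ℕ → Set (Torus d)) (C a l r : ℝ) : Prop where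
  amplitude_nonneg : 0 ≤ a
  amplitude_lt_one : a < 1
  one_le_slope : 1 ≤ l
  volume_nonneg : 0 ≤ r
  isLocalized : ∀ i, IsLocalized (F i) (F' i) (C * a ^ i) (C * l ^ i) (S i)
  disjoint : Pairwise (Function.onFun Disjoint S)
  volume_le : ∀ i, volume (S i) ≤ ENNReal.ofReal (C * r ^ i)

lemma mul_pow_rpow {c b : ℝ} (hc : 0 ≤ c) (hb : 0 ≤ b) (i : ℕ) (s : ℝ) :
    (c * b ^ i) ^ s = c ^ s * (b ^ s) ^ i := by
  rw [Real.mul_rpow hc (by positivity), ← Real.rpow_natCast, ← Real.rpow_natCast,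
    ← Real.rpow_mul hb, ← Real.rpow_mul hb, mul_comm s]

namespace IsGeometric

variable {d : ℕ} {F : ℕ → Torus d → ℝ} {F' : ℕ → Fin d → Torus d → ℝ}
    {S : ℕ → Set (Torus d)} {C a l r : ℝ}

lemma const_nonneg (h : IsGeometric F F' S C a l r) : 0 ≤ C := by
  simpa using (h.isLocalized 0).amplitude_nonneg

lemma slope_nonneg (h : IsGeometric F F' S C a l r) : 0 ≤ l := zero_le_one.trans h.one_le_slope

lemma slope_mul_lt_one (h : IsGeometric F F' S C a l r) {p : ℝ} (hp : 1 ≤ p)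
    (hlr : l ^ p * r < 1) : l * r < 1 :=
  (mul_le_mul_of_nonneg_right (Real.self_le_rpow_of_one_le h.one_le_slope hp)
    h.volume_nonneg).trans_lt hlr

lemma summable_amplitude (h : IsGeometric F F' S C a l r) : Summable fun i => C * a ^ i :=
  (summable_geometric_of_lt_one h.amplitude_nonneg h.amplitude_lt_one).mul_left C

lemma summable (h : IsGeometric F F' S C a l r) (x : Torus d) : Summable fun i => F i x :=
  Summable.of_norm_bounded h.summable_amplitude fun i => (h.isLocalized i).abs_le x

lemma continuous_tsum (h : IsGeometric F F' S C a l r) : Continuous fun x => ∑' i, F i x :=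
  _root_.continuous_tsum (fun i => (h.isLocalized i).continuous) h.summable_amplitude
    fun i x => (h.isLocalized i).abs_le x

lemma memHolder_tsum (h : IsGeometric F F' S C a l r) {α : ℝ≥0} (hα : α ≤ 1)
    (hal : a ^ (1 - α : ℝ) * l ^ (α : ℝ) < 1) : MemHolder α fun x => ∑' i, F i x := by
  have hC := h.const_nonneg
  have ha := h.amplitude_nonneg
  have hl := h.slope_nonneg
  set q : ℝ := a ^ (1 - α : ℝ) * l ^ (α : ℝ) with hq
  have hincr : ∀ i x y, ‖F i x - F i y‖
      ≤ (2 * C) ^ (1 - α : ℝ) * (d * C) ^ (α : ℝ) * q ^ i * dist x y ^ (α : ℝ) := by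
    intro i x y
    refine ((h.isLocalized i).abs_sub_le_rpow (by positivity) α.coe_nonneg
      (by exact_mod_cast hα) x y).trans_eq ?_
    rw [← mul_assoc, ← mul_assoc, mul_pow_rpow (by positivity) ha,
      mul_pow_rpow (by positivity) hl, hq, mul_pow]
    ring
  have hsum := (summable_geometric_of_lt_one (by positivity) hal).mul_left
    ((2 * C) ^ (1 - α : ℝ) * (d * C) ^ (α : ℝ))
  refine memHolder_of_dist_le
    (K := ∑' i, (2 * C) ^ (1 - α : ℝ) * (d * C) ^ (α : ℝ) * q ^ i) fun x y => ?_
  rw [dist_eq_norm, ← (h.summable x).tsum_sub (h.summable y)]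
  exact tsum_of_norm_bounded (hsum.hasSum.mul_right _) fun i => hincr i x y

lemma disjoint_support_deriv (h : IsGeometric F F' S C a l r) (j : Fin d) :
    Pairwise (Function.onFun Disjoint fun i => Function.support (F' i j)) := by
  have hsupp : ∀ i, Function.support (F' i j) ⊆ S i := fun i x hx => by
    by_contra hxS
    exact hx ((h.isLocalized i).deriv_eq_zero j x hxS)
  exact fun i k hik => (h.disjoint hik).mono (hsupp i) (hsupp k)

lemma summable_deriv (h : IsGeometric F F' S C a l r) (j : Fin d) (x : Torus d) :
    Summable fun i => F' i j x :=
  (exists_hasSum_apply_of_disjoint_support (h.disjoint_support_deriv j) x).choose_spec.summable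

lemma tsum_lintegral_rpow_lt_top (h : IsGeometric F F' S C a l r) (j : Fin d) {p : ℝ} (hp : 0 < p)
    (hlr : l ^ p * r < 1) : ∑' i, ∫⁻ x, ‖F' i j x‖ₑ ^ p < ⊤ := by
  have hC := h.const_nonneg
  have hl := h.slope_nonneg
  have hr := h.volume_nonneg
  have hterm : ∀ i, ∫⁻ x, ‖F' i j x‖ₑ ^ p ≤ ENNReal.ofReal (C ^ p * C * (l ^ p * r) ^ i) := by
    intro i
    calc ∫⁻ x, ‖F' i j x‖ₑ ^ p ≤ ENNReal.ofReal (C * l ^ i) ^ p * ENNReal.ofReal (C * r ^ i) :=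
          ((h.isLocalized i).lintegral_rpow_le j hp).trans (by gcongr; exact h.volume_le i)
      _ = ENNReal.ofReal (C ^ p * C * (l ^ p * r) ^ i) := by
          rw [ENNReal.ofReal_rpow_of_nonneg (by positivity) hp.le,
            ← ENNReal.ofReal_mul (by positivity), mul_pow_rpow hC hl]
          congr 1
          ring
  have hsum : Summable fun i => C ^ p * C * (l ^ p * r) ^ i :=
    (summable_geometric_of_lt_one (by positivity) hlr).mul_left _
  refine (ENNReal.tsum_le_tsum hterm).trans_lt ?_
  rw [← ENNReal.ofReal_tsum_of_nonneg (fun i => by positivity) hsum]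
  exact ENNReal.ofReal_lt_top

lemma memLp_tsum_deriv (h : IsGeometric F F' S C a l r) (j : Fin d) {p : ℝ} (hp : 0 < p)
    (hlr : l ^ p * r < 1) : MemLp (fun x => ∑' i, F' i j x) (ENNReal.ofReal p) :=
  memLp_tsum_of_disjoint_support (fun i => ((h.isLocalized i).continuous_deriv j).measurable)
    (h.disjoint_support_deriv j) hp (h.tsum_lintegral_rpow_lt_top j hp hlr)

lemma hasWeakPartialDeriv_tsum (h : IsGeometric F F' S C a l r) (j : Fin d) (hlr : l * r < 1) :
    HasWeakPartialDeriv j (fun x => ∑' i, F i x) (fun x => ∑' i, F' i j x) := by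
  refine HasWeakPartialDeriv.tsum (fun i => (h.isLocalized i).hasWeakPartialDeriv j) ?_ ?_
  · refine Summable.of_nonneg_of_le (fun i => integral_nonneg fun x => norm_nonneg _)
      (fun i => ?_) (h.summable_amplitude.mul_left (volume.real (univ : Set (Torus d))))
    calc ∫ x, ‖F i x‖ ≤ ∫ _ : Torus d, C * a ^ i :=
          integral_mono (integrable_of_continuous (h.isLocalized i).continuous.norm)
            (integrable_const _) (h.isLocalized i).abs_le
      _ = volume.real univ * (C * a ^ i) := by rw [integral_const, smul_eq_mul]
  · have hfin := h.tsum_lintegral_rpow_lt_top j one_pos (by simpa using hlr)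
    refine (ENNReal.summable_toReal hfin.ne).congr fun i => ?_
    rw [integral_norm_eq_lintegral_enorm
      ((h.isLocalized i).continuous_deriv j).aestronglyMeasurable]
    simp

end IsGeometric

/-! ### Bump functions on the line and on the circle -/

/-- A smooth function on the line whose closed support lies in `S`. -/
structure IsBumpOn (S : Set ℝ) (f : ℝ → ℝ) : Prop where
  contDiff : ContDiff ℝ ∞ f
  tsupport_subset : tsupport f ⊆ S

namespace IsBumpOn

variable {S : Set ℝ} {f : ℝ → ℝ}

lemma eq_zero (h : IsBumpOn S f) {z : ℝ} (hz : z ∉ S) : f z = 0 :=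
  image_eq_zero_of_notMem_tsupport fun hz' => hz (h.tsupport_subset hz')

lemma deriv (h : IsBumpOn S f) : IsBumpOn S (deriv f) where
  contDiff := (contDiff_infty_iff_deriv.1 h.contDiff).2
  tsupport_subset := (closure_minimal support_deriv_subset (isClosed_tsupport f)).trans
    h.tsupport_subset

lemma hasDerivAt (h : IsBumpOn S f) (x : ℝ) : HasDerivAt f (_root_.deriv f x) x :=
  (h.contDiff.differentiable (by simp)).differentiableAt.hasDerivAt

lemma eventually_abs_le (h : IsBumpOn S f) (hS : Bornology.IsBounded S) :
    ∀ᶠ K in Filter.atTop, ∀ z, |f z| ≤ K := by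
  have hcompact : HasCompactSupport f :=
    Metric.isCompact_of_isClosed_isBounded (isClosed_tsupport f) (hS.subset h.tsupport_subset)
  obtain ⟨K₀, hK₀⟩ := hcompact.exists_bound_of_continuous h.contDiff.continuous
  filter_upwards [Filter.eventually_ge_atTop K₀] with K hK z using (hK₀ z).trans hK

end IsBumpOn

/-- `g'` is the derivative of the function `g` on the circle. -/
def HasCircleDeriv (g g' : UnitAddCircle → ℝ) : Prop :=
  ∀ x : ℝ, HasDerivAt (fun s : ℝ => g (s : UnitAddCircle)) (g' (x : UnitAddCircle)) x

namespace HasCircleDeriv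

variable {g g' : UnitAddCircle → ℝ}

lemma continuous (h : HasCircleDeriv g g') : Continuous g := by
  rw [QuotientAddGroup.isOpenQuotientMap_mk.isQuotientMap.continuous_iff]
  exact continuous_iff_continuousAt.2 fun x => (h x).continuousAt

lemma comp (h : HasCircleDeriv g g') (a : UnitAddCircle) {φ : ℝ → ℝ} {φ' s : ℝ}
    (hφ : HasDerivAt φ φ' s) :
    HasDerivAt (fun s => g (a + (φ s : UnitAddCircle)))
      (g' (a + (φ s : UnitAddCircle)) * φ') s := by
  obtain ⟨r, rfl⟩ := QuotientAddGroup.mk_surjective a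
  simpa only [Function.comp_def, AddCircle.coe_add] using
    HasDerivAt.comp s (h (r + φ s)) (hφ.const_add r)

lemma hasPartialDeriv_comp (h : HasCircleDeriv g g') {d : ℕ} {j : Fin d}
    {v : Torus d → UnitAddCircle} {φ : Torus d → ℝ → ℝ} {φ' : Torus d → ℝ}
    (hv : ∀ x (s : ℝ), v (x + Pi.single j (s : UnitAddCircle)) = v x + (φ x s : UnitAddCircle))
    (hφ : ∀ x, HasDerivAt (φ x) (φ' x) 0) :
    HasPartialDeriv j (fun x => g (v x)) (fun x => g' (v x) * φ' x) := by
  intro x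
  have hcomp := h.comp (v x) (hφ x)
  simp only [← hv x, AddCircle.coe_zero, Pi.single_zero, add_zero] at hcomp
  exact hcomp

end HasCircleDeriv

/-- The periodic extension of the restriction of a function to `[0, 1)`. -/
def periodize (f : ℝ → ℝ) : UnitAddCircle → ℝ :=
  Function.Periodic.lift (f := fun t : ℝ => f (Int.fract t)) (c := (1 : ℝ)) fun t => by simp

lemma periodize_coe (f : ℝ → ℝ) (x : ℝ) : periodize f (x : UnitAddCircle) = f (Int.fract x) := rfl

lemma periodize_coe_eq_add {f : ℝ → ℝ} (h₀ : ∀ t ≤ 0, f t = 0) (h₁ : ∀ t, 1 ≤ t → f t = 0) {k : ℤ}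
    {t : ℝ} (hkt : k - 1 < t) (htk : t < k + 1) :
    periodize f (t : UnitAddCircle) = f (t - k) + f (t - k + 1) := by
  rw [periodize_coe]
  rcases lt_or_ge t k with h | h
  · have hfloor : ⌊t⌋ = k - 1 := by
      rw [Int.floor_eq_iff]
      push_cast
      constructor <;> linarith
    rw [← Int.self_sub_floor, hfloor, h₀ (t - k) (by linarith), zero_add]
    push_cast
    congr 1
    ring
  · have hfloor : ⌊t⌋ = k := Int.floor_eq_iff.2 ⟨h, htk⟩
    rw [← Int.self_sub_floor, hfloor, h₁ (t - k + 1) (by linarith), add_zero]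

lemma hasCircleDeriv_periodize {f f' : ℝ → ℝ} (hf : ∀ x, HasDerivAt f (f' x) x)
    (h₀ : ∀ t ≤ 0, f t = 0) (h₁ : ∀ t, 1 ≤ t → f t = 0) :
    HasCircleDeriv (periodize f) (periodize f') := by
  intro x
  have hlt : (⌊x⌋ - 1 : ℝ) < x := by linarith [Int.floor_le x]
  have hlocal : (fun t : ℝ => periodize f (t : UnitAddCircle)) =ᶠ[nhds x]
      fun t => f (t - ⌊x⌋) + f (t - ⌊x⌋ + 1) := by
    filter_upwards [Ioo_mem_nhds hlt (Int.lt_floor_add_one x)] with t ht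
      using periodize_coe_eq_add h₀ h₁ ht.1 ht.2
  have hderiv_ge : f' (x - ⌊x⌋ + 1) = 0 := by
    have hmem : 1 ≤ x - ⌊x⌋ + 1 := by linarith [Int.floor_le x]
    exact (uniqueDiffWithinAt_Ici _).eq_deriv _ (hf _).hasDerivWithinAt
      ((hasDerivWithinAt_const _ _ 0).congr (fun t ht => h₁ t (hmem.trans ht)) (h₁ _ hmem))
  have hsum : HasDerivAt (fun t => f (t - ⌊x⌋) + f (t - ⌊x⌋ + 1))
      (f' (x - ⌊x⌋) + f' (x - ⌊x⌋ + 1)) x :=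
    (HasDerivAt.comp_sub_const x _ (hf _)).add
      (HasDerivAt.comp_sub_const x (⌊x⌋ : ℝ) (HasDerivAt.comp_add_const _ 1 (hf _)))
  rw [hderiv_ge, add_zero, Int.self_sub_floor] at hsum
  exact hsum.congr_of_eventuallyEq hlocal

/-- The periodic function that is `z ↦ f (z / ρ)` near the integers. -/
def latticeBump (f : ℝ → ℝ) (ρ : ℝ) (a : UnitAddCircle) : ℝ :=
  periodize (fun t => f ((t - 1 / 2) / ρ)) (a + ((1 / 2 : ℝ) : UnitAddCircle))

section LatticeBump

variable {f : ℝ → ℝ} {ρ : ℝ}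

lemma latticeBump_coe (f : ℝ → ℝ) (ρ z : ℝ) :
    latticeBump f ρ (z : UnitAddCircle) = f ((z - round z) / ρ) := by
  rw [latticeBump, ← AddCircle.coe_add, periodize_coe, round_eq, ← Int.self_sub_floor]
  congr 2
  ring

lemma latticeBump_coe_of_mem_Ico (f : ℝ → ℝ) (ρ : ℝ) {z : ℝ} (hz : z ∈ Ico (-(1 / 2) : ℝ) (1 / 2)) :
    latticeBump f ρ (z : UnitAddCircle) = f (z / ρ) := by
  rw [latticeBump_coe, round_eq_zero_iff.2 hz, Int.cast_zero, sub_zero]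

lemma abs_latticeBump_le {K : ℝ} (hK : ∀ z, |f z| ≤ K) (ρ : ℝ) (a : UnitAddCircle) :
    |latticeBump f ρ a| ≤ K := by
  obtain ⟨z, rfl⟩ := QuotientAddGroup.mk_surjective a
  exact (congrArg abs (latticeBump_coe f ρ z)).trans_le (hK _)

lemma div_notMem_ball {R z : ℝ} (hρ : 0 < ρ) (hz : R * ρ ≤ |z|) : z / ρ ∉ Metric.ball 0 R := by
  rw [mem_ball_zero_iff, Real.norm_eq_abs, abs_div, abs_of_pos hρ, not_lt]
  exact (le_div_iff₀ hρ).2 hz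

lemma latticeBump_eq_zero {R : ℝ} (hf : IsBumpOn (Metric.ball 0 R) f) (hρ : 0 < ρ)
    {a : UnitAddCircle} (ha : R * ρ ≤ ‖a‖) : latticeBump f ρ a = 0 := by
  obtain ⟨z, rfl⟩ := QuotientAddGroup.mk_surjective a
  change R * ρ ≤ ‖(z : UnitAddCircle)‖ at ha
  rw [UnitAddCircle.norm_eq] at ha
  exact (latticeBump_coe f ρ z).trans (hf.eq_zero (div_notMem_ball hρ ha))

lemma hasCircleDeriv_latticeBump {R : ℝ} (hf : IsBumpOn (Metric.ball 0 R) f) (hρ : 0 < ρ)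
    (hRρ : R * ρ ≤ 1 / 2) :
    HasCircleDeriv (latticeBump f ρ) (fun a => latticeBump (deriv f) ρ a / ρ) := by
  have hderiv : ∀ x, HasDerivAt (fun t => f ((t - 1 / 2) / ρ))
      (deriv f ((x - 1 / 2) / ρ) / ρ) x := fun x => by
    simpa only [Function.comp_def, mul_one_div, id] using HasDerivAt.comp x (hf.hasDerivAt _)
      (((hasDerivAt_id x).sub_const (1 / 2)).div_const ρ)
  have hzero : ∀ t, 1 / 2 ≤ |t - 1 / 2| → f ((t - 1 / 2) / ρ) = 0 := fun t ht =>
    hf.eq_zero (div_notMem_ball hρ (hRρ.trans ht))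
  have hperiodic := hasCircleDeriv_periodize hderiv
    (fun t ht => hzero t (by rw [abs_of_nonpos] <;> linarith))
    (fun t ht => hzero t (by rw [abs_of_nonneg] <;> linarith))
  intro x
  have hshift := HasDerivAt.comp_add_const x (1 / 2 : ℝ) (hperiodic (x + 1 / 2))
  simp only [AddCircle.coe_add] at hshift
  exact hshift

end LatticeBump

/-! ### Products of periodic bumps with moving centres -/

section Block

variable {n : ℕ}

/-- The offset of the point `x` from the centres of a block in the direction `m.succ`: it vanishes
at the points with `M • x m.succ = c m (x 0)`. -/
def offset (c : Fin n → UnitAddCircle → ℝ) (M : ℕ) (m : Fin n) (x : Torus (n + 1)) :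
    UnitAddCircle :=
  M • x m.succ - ((c m (x 0) : ℝ) : UnitAddCircle)

/-- The partial derivative in the direction `j` of the (lifted) offset in the direction `m`. -/
def offsetDeriv (c' : Fin n → UnitAddCircle → ℝ) (M : ℕ) (j : Fin (n + 1)) (m : Fin n)
    (x : Torus (n + 1)) : ℝ :=
  Fin.cases (-c' m (x 0)) (fun k => if m = k then (M : ℝ) else 0) j

/-- The product of an amplitude, which depends on the coordinate `x 0`, and of bumps of radius `ρ`
in the other coordinates, around the moving centres. -/
def block (g : UnitAddCircle → ℝ) (c : Fin n → UnitAddCircle → ℝ) (f : Fin n → ℝ → ℝ) (ρ : ℝ)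
    (M : ℕ) (x : Torus (n + 1)) : ℝ :=
  g (x 0) * ∏ m, latticeBump (f m) ρ (offset c M m x)

/-- The partial derivatives of a block. -/
def blockDeriv (g g' : UnitAddCircle → ℝ) (c c' : Fin n → UnitAddCircle → ℝ)
    (f : Fin n → ℝ → ℝ) (ρ : ℝ) (M : ℕ) (j : Fin (n + 1)) (x : Torus (n + 1)) : ℝ :=
  (if j = 0 then block g' c f ρ M x else 0)
    + ∑ m, offsetDeriv c' M j m x / ρ * block g c (Function.update f m (deriv (f m))) ρ M x

/-- The points at distance at most `δ` from the moving centres, while the amplitude is active. -/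
def blockSupport (I : Set UnitAddCircle) (c : Fin n → UnitAddCircle → ℝ) (δ : ℝ) (M : ℕ) :
    Set (Torus (n + 1)) :=
  {x | x 0 ∈ I ∧ ∀ m : Fin n, ‖offset c M m x‖ ≤ δ}

variable {g g' : UnitAddCircle → ℝ} {c c' : Fin n → UnitAddCircle → ℝ}
  {f : Fin n → ℝ → ℝ} {ρ R : ℝ} {M : ℕ}

lemma continuous_offset {m : Fin n} (hc : Continuous (c m)) : Continuous (offset c M m) := by
  have hcentre : Continuous fun x : Torus (n + 1) => ((c m (x 0) : ℝ) : UnitAddCircle) :=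
    (AddCircle.continuous_mk' (1 : ℝ)).comp (hc.comp (continuous_apply 0))
  exact ((continuous_nsmul M).comp (continuous_apply m.succ)).sub hcentre

lemma continuous_offsetDeriv {m : Fin n} (hc' : Continuous (c' m)) (j : Fin (n + 1)) :
    Continuous (offsetDeriv c' M j m) := by
  cases j using Fin.cases with
  | zero => exact (hc'.comp (continuous_apply 0)).neg
  | succ k => exact continuous_const

lemma abs_offsetDeriv_le {Q : ℝ} (hQ : ∀ m a, |c' m a| ≤ Q) (hM : M ≤ Q) (j : Fin (n + 1))
    (m : Fin n) (x : Torus (n + 1)) : |offsetDeriv c' M j m x| ≤ Q := by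
  cases j using Fin.cases with
  | zero => simpa [offsetDeriv] using hQ m (x 0)
  | succ k =>
    have hQ₀ : 0 ≤ Q := M.cast_nonneg.trans hM
    simp only [offsetDeriv, Fin.cases_succ]
    split_ifs <;> simpa

lemma HasCircleDeriv.hasPartialDeriv_apply_zero (hg : HasCircleDeriv g g') (j : Fin (n + 1)) :
    HasPartialDeriv j (fun x => g (x 0)) (fun x => g' (x 0) * if j = 0 then 1 else 0) := by
  refine hg.hasPartialDeriv_comp (φ := fun _ s => if j = 0 then s else 0) (fun x s => ?_)
    fun _ => ?_
  · split_ifs with hj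
    · simp [hj]
    · simp [Pi.single_eq_of_ne (Ne.symm hj)]
  · split_ifs
    exacts [hasDerivAt_id 0, hasDerivAt_const _ _]

lemma HasCircleDeriv.hasPartialDeriv_comp_offset (hg : HasCircleDeriv g g') {m : Fin n}
    (hc : HasCircleDeriv (c m) (c' m)) (j : Fin (n + 1)) :
    HasPartialDeriv j (fun x => g (offset c M m x))
      (fun x => g' (offset c M m x) * offsetDeriv c' M j m x) := by
  cases j using Fin.cases with
  | zero =>
    refine hg.hasPartialDeriv_comp
      (φ := fun x s => c m (x 0) - c m (x 0 + (s : UnitAddCircle))) (fun x s => ?_) fun x => ?_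
    · simp [offset]
    · simpa [offsetDeriv] using (hc.comp (x 0) (hasDerivAt_id (0 : ℝ))).const_sub (c m (x 0))
  | succ k =>
    refine hg.hasPartialDeriv_comp (φ := fun _ s => (if m = k then (M : ℝ) else 0) * s)
      (fun x s => ?_) fun x => ?_
    · rcases eq_or_ne m k with rfl | hmk
      · simp only [offset, Pi.add_apply, Pi.single_eq_same, smul_add, if_true,
          Pi.single_eq_of_ne (Fin.succ_ne_zero m).symm, add_zero, ← nsmul_eq_mul,
          AddCircle.coe_nsmul]
        abel
      · simp [offset, hmk]
    · simpa [offsetDeriv] using (hasDerivAt_id (0 : ℝ)).const_mul (if m = k then (M : ℝ) else 0)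

lemma continuous_block (hg : Continuous g) (hc : ∀ m, Continuous (c m))
    (hf : ∀ m, IsBumpOn (Metric.ball 0 R) (f m)) (hρ : 0 < ρ) (hRρ : R * ρ ≤ 1 / 2) :
    Continuous (block g c f ρ M) :=
  (hg.comp (continuous_apply 0)).mul <| continuous_finsetProd _ fun m _ =>
    (hasCircleDeriv_latticeBump (hf m) hρ hRρ).continuous.comp (continuous_offset (hc m))

lemma isBumpOn_update_deriv {S : Set ℝ} (hf : ∀ m, IsBumpOn S (f m)) (m m' : Fin n) :
    IsBumpOn S (Function.update f m (deriv (f m)) m') := by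
  rcases eq_or_ne m' m with rfl | h
  · simpa using (hf m').deriv
  · simpa [h] using hf m'

lemma block_update (m : Fin n) (h : ℝ → ℝ) (x : Torus (n + 1)) :
    block g c (Function.update f m h) ρ M x = g (x 0) *
      ((∏ m' ∈ Finset.univ.erase m, latticeBump (f m') ρ (offset c M m' x)) *
        latticeBump h ρ (offset c M m x)) := by
  rw [block, ← Finset.prod_erase_mul _ _ (Finset.mem_univ m), Function.update_self]
  congr 2
  refine Finset.prod_congr rfl fun m' hm' => ?_
  rw [Function.update_of_ne (Finset.ne_of_mem_erase hm')]

lemma hasPartialDeriv_block (hg : HasCircleDeriv g g') (hc : ∀ m, HasCircleDeriv (c m) (c' m))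
    (hf : ∀ m, IsBumpOn (Metric.ball 0 R) (f m)) (hρ : 0 < ρ) (hRρ : R * ρ ≤ 1 / 2)
    (j : Fin (n + 1)) :
    HasPartialDeriv j (block g c f ρ M) (blockDeriv g g' c c' f ρ M j) := by
  have hfactor : ∀ m, HasPartialDeriv j (fun x => latticeBump (f m) ρ (offset c M m x))
      (fun x => latticeBump (deriv (f m)) ρ (offset c M m x) / ρ * offsetDeriv c' M j m x) :=
    fun m => (hasCircleDeriv_latticeBump (hf m) hρ hRρ).hasPartialDeriv_comp_offset (hc m) j
  convert! (hg.hasPartialDeriv_apply_zero j).mul (HasPartialDeriv.prod fun m _ => hfactor m) using 2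
    with x
  rw [blockDeriv, Finset.mul_sum]
  congr 1
  · rw [mul_assoc, ite_mul, one_mul, zero_mul, mul_ite, mul_zero, block]
  · refine Finset.sum_congr rfl fun m _ => ?_
    rw [block_update]
    ring

lemma abs_block_le {A K : ℝ} (hg : ∀ a, |g a| ≤ A) (hK : ∀ m z, |f m z| ≤ K) (x : Torus (n + 1)) :
    |block g c f ρ M x| ≤ A * K ^ n := by
  rw [block, abs_mul, Finset.abs_prod]
  refine mul_le_mul (hg _) ?_ (Finset.prod_nonneg fun _ _ => abs_nonneg _)
    ((abs_nonneg _).trans (hg 0))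
  calc ∏ m, |latticeBump (f m) ρ (offset c M m x)|
      ≤ ∏ _m : Fin n, K := Finset.prod_le_prod (fun _ _ => abs_nonneg _)
        fun m _ => abs_latticeBump_le (hK m) ρ _
    _ = K ^ n := by rw [Finset.prod_const, Finset.card_univ, Fintype.card_fin]

lemma abs_blockDeriv_le {A A' Q K : ℝ} (hρ : 0 < ρ) (hA : ∀ a, |g a| ≤ A)
    (hA' : ∀ a, |g' a| ≤ A') (hQ : ∀ m a, |c' m a| ≤ Q) (hM : M ≤ Q) (hK : ∀ m z, |f m z| ≤ K)
    (hK' : ∀ m z, |deriv (f m) z| ≤ K) (j : Fin (n + 1)) (x : Torus (n + 1)) :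
    |blockDeriv g g' c c' f ρ M j x| ≤ A' * K ^ n + n * (Q / ρ * (A * K ^ n)) := by
  have hamplitude : |if j = 0 then block g' c f ρ M x else 0| ≤ A' * K ^ n := by
    have hblock := abs_block_le (c := c) (ρ := ρ) (M := M) hA' hK x
    split_ifs
    · exact hblock
    · rw [abs_zero]
      exact (abs_nonneg _).trans hblock
  have hupdate : ∀ m m' z, |Function.update f m (deriv (f m)) m' z| ≤ K := by
    intro m m' z
    rcases eq_or_ne m' m with rfl | h
    · simpa using hK' m' z
    · simpa [h] using hK m' z
  have hfactor : ∀ m, |offsetDeriv c' M j m x / ρ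
      * block g c (Function.update f m (deriv (f m))) ρ M x| ≤ Q / ρ * (A * K ^ n) := by
    intro m
    have hQ₀ : 0 ≤ Q := M.cast_nonneg.trans hM
    rw [abs_mul, abs_div, abs_of_pos hρ]
    gcongr
    · exact abs_offsetDeriv_le hQ hM j m x
    · exact abs_block_le hA (hupdate m) x
  refine (abs_add_le _ _).trans (add_le_add hamplitude ?_)
  refine (Finset.abs_sum_le_sum_abs _ _).trans
    ((Finset.sum_le_sum fun m _ => hfactor m).trans_eq ?_)
  rw [Finset.sum_const, Finset.card_univ, Fintype.card_fin, nsmul_eq_mul]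

lemma block_eq_zero (hf : ∀ m, IsBumpOn (Metric.ball 0 R) (f m)) (hρ : 0 < ρ)
    {I : Set UnitAddCircle} (hI : ∀ a ∉ I, g a = 0) {x : Torus (n + 1)}
    (hx : x ∉ blockSupport I c (R * ρ) M) : block g c f ρ M x = 0 := by
  by_cases h₀ : x 0 ∈ I
  · obtain ⟨m, hm⟩ : ∃ m : Fin n, R * ρ < ‖offset c M m x‖ := by
      by_contra! hcon
      exact hx ⟨h₀, hcon⟩
    rw [block, Finset.prod_eq_zero (Finset.mem_univ m) (latticeBump_eq_zero (hf m) hρ hm.le),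
      mul_zero]
  · rw [block, hI _ h₀, zero_mul]

lemma isLocalized_block (hg : HasCircleDeriv g g') (hg' : Continuous g')
    (hc : ∀ m, HasCircleDeriv (c m) (c' m)) (hc' : ∀ m, Continuous (c' m))
    (hf : ∀ m, IsBumpOn (Metric.ball 0 R) (f m)) (hρ : 0 < ρ) (hRρ : R * ρ ≤ 1 / 2)
    {I : Set UnitAddCircle} (hI : ∀ a ∉ I, g a = 0) (hI' : ∀ a ∉ I, g' a = 0) {A A' Q K : ℝ}
    (hA : ∀ a, |g a| ≤ A) (hA' : ∀ a, |g' a| ≤ A') (hQ : ∀ m a, |c' m a| ≤ Q) (hM : M ≤ Q)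
    (hK : ∀ m z, |f m z| ≤ K) (hK' : ∀ m z, |deriv (f m) z| ≤ K) :
    IsLocalized (block g c f ρ M) (blockDeriv g g' c c' f ρ M) (A * K ^ n)
      (A' * K ^ n + n * (Q / ρ * (A * K ^ n))) (blockSupport I c (R * ρ) M) where
  continuous := continuous_block hg.continuous (fun m => (hc m).continuous) hf hρ hRρ
  continuous_deriv j := by
    have hcont := fun m => (hc m).continuous
    refine Continuous.add ?_ (continuous_finsetSum _ fun m _ => ?_)
    · split_ifs
      exacts [continuous_block hg' hcont hf hρ hRρ, continuous_const]
    · exact ((continuous_offsetDeriv (hc' m) j).div_const ρ).mul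
        (continuous_block hg.continuous hcont (isBumpOn_update_deriv hf m) hρ hRρ)
  hasPartialDeriv := hasPartialDeriv_block hg hc hf hρ hRρ
  abs_le := abs_block_le hA hK
  abs_deriv_le := abs_blockDeriv_le hρ hA hA' hQ hM hK hK'
  deriv_eq_zero j x hx := by
    rw [blockDeriv, block_eq_zero hf hρ hI' hx, ite_self, zero_add]
    exact Finset.sum_eq_zero fun m _ => by
      rw [block_eq_zero (isBumpOn_update_deriv hf m) hρ hI hx, mul_zero]

lemma measurePreserving_nsmul_circle (hM : 0 < M) :
    MeasurePreserving (fun y : UnitAddCircle => M • y) volume volume := by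
  rcases (Nat.one_le_iff_ne_zero.2 hM.ne').eq_or_lt with rfl | h
  · simp only [one_smul]
    exact MeasurePreserving.id (volume : Measure UnitAddCircle)
  · exact (AddCircle.ergodic_nsmul h).toMeasurePreserving

lemma volume_pi_preimage_nsmul_closedBall_le {δ : ℝ} (hδ : 0 ≤ δ) (hM : 0 < M)
    (b : Fin n → UnitAddCircle) :
    volume (Set.pi univ fun m : Fin n =>
      (fun y : UnitAddCircle => M • y) ⁻¹' Metric.closedBall (b m) δ)
        ≤ ENNReal.ofReal ((2 * δ) ^ n) := by
  rw [volume_pi_pi]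
  calc ∏ m, volume ((fun y : UnitAddCircle => M • y) ⁻¹' Metric.closedBall (b m) δ)
      ≤ ∏ _m : Fin n, ENNReal.ofReal (2 * δ) := by
        refine Finset.prod_le_prod' fun m _ => ?_
        rw [(measurePreserving_nsmul_circle hM).measure_preimage
          Metric.isClosed_closedBall.measurableSet.nullMeasurableSet,
          AddCircle.volume_closedBall]
        exact ENNReal.ofReal_le_ofReal (min_le_right _ _)
    _ = ENNReal.ofReal ((2 * δ) ^ n) := by
        rw [Finset.prod_const, Finset.card_univ, Fintype.card_fin,
          ENNReal.ofReal_pow (by positivity)]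

-- By Fubini, it suffices to bound the slices at a fixed `x 0`, which are products of preimages of
-- balls under the measure preserving maps `y ↦ M • y`.
lemma volume_blockSupport_le (I : Set UnitAddCircle) (hc : ∀ m, Continuous (c m)) {δ : ℝ}
    (hδ : 0 ≤ δ) (hM : 0 < M) :
    volume (blockSupport I c δ M) ≤ ENNReal.ofReal ((2 * δ) ^ n) := by
  have hsplit := volume_preserving_piFinSuccAbove (fun _ : Fin (n + 1) => UnitAddCircle) 0
  set E : Set (UnitAddCircle × (Fin n → UnitAddCircle)) :=
    {q | ∀ m : Fin n, ‖M • q.2 m - ((c m q.1 : ℝ) : UnitAddCircle)‖ ≤ δ} with hE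
  have hclosed : IsClosed E := by
    rw [hE, Set.ofPred_forall]
    refine isClosed_iInter fun m => isClosed_le (Continuous.norm ?_) continuous_const
    refine ((continuous_nsmul M).comp ((continuous_apply m).comp continuous_snd)).sub ?_
    exact (AddCircle.continuous_mk' (1 : ℝ)).comp ((hc m).comp continuous_fst)
  have hslice : ∀ s, volume (Prod.mk s ⁻¹' E) ≤ ENNReal.ofReal ((2 * δ) ^ n) := by
    intro s
    have hpi : Prod.mk s ⁻¹' E = Set.pi univ fun m : Fin n =>
        (fun y : UnitAddCircle => M • y) ⁻¹' Metric.closedBall ((c m s : ℝ) : UnitAddCircle) δ := by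
      ext y
      simp [hE, dist_eq_norm]
    exact hpi ▸ volume_pi_preimage_nsmul_closedBall_le hδ hM _
  calc volume (blockSupport I c δ M)
      ≤ volume (MeasurableEquiv.piFinSuccAbove (fun _ : Fin (n + 1) => UnitAddCircle) 0 ⁻¹' E) :=
        measure_mono fun x hx m => hx.2 m
    _ = (volume.prod volume) E := hsplit.measure_preimage hclosed.measurableSet.nullMeasurableSet
    _ = ∫⁻ s, volume (Prod.mk s ⁻¹' E) := Measure.prod_apply hclosed.measurableSet
    _ ≤ ∫⁻ _ : UnitAddCircle, ENNReal.ofReal ((2 * δ) ^ n) := lintegral_mono hslice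
    _ = ENNReal.ofReal ((2 * δ) ^ n) := by simp

end Block

/-! ### Smooth clocks -/

/-- A smooth function supported in `[1/2, 7/8]`; the generations are switched on and off by rescaled
pulses. -/
abbrev IsPulse (f : ℝ → ℝ) : Prop := IsBumpOn (Icc (1 / 2) (7 / 8)) f

/-- The times at which the `i`-th generation may be active. -/
def activeSet (i : ℕ) : Set UnitAddCircle :=
  (fun s : ℝ => (s : UnitAddCircle)) '' {s : ℝ | (2 : ℝ) ^ i * s ∈ Icc (1 / 2 : ℝ) (7 / 8)}

/-- The periodic function that is `s ↦ f (2 ^ i * s)` on `[0, 1)`. -/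
def clock (f : ℝ → ℝ) (i : ℕ) : UnitAddCircle → ℝ := periodize fun s => f (2 ^ i * s)

section Clock

variable {f : ℝ → ℝ} {i : ℕ}

lemma isPulse_of_contDiff (hf : ContDiff ℝ ∞ f) (h₀ : ∀ t < 1 / 2, f t = 0)
    (h₁ : ∀ t, 7 / 8 < t → f t = 0) : IsPulse f where
  contDiff := hf
  tsupport_subset := closure_minimal (fun t ht => by
    by_contra! hmem
    rw [mem_Icc, not_and_or, not_le, not_le] at hmem
    exact ht (hmem.elim (h₀ t) (h₁ t))) isClosed_Icc

lemma IsPulse.apply_two_pow_mul_of_nonpos (hf : IsPulse f) {t : ℝ} (ht : t ≤ 0) :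
    f (2 ^ i * t) = 0 :=
  hf.eq_zero fun h => by
    linarith [h.1, mul_nonpos_of_nonneg_of_nonpos (by positivity : (0 : ℝ) ≤ 2 ^ i) ht]

lemma IsPulse.apply_two_pow_mul_of_one_le (hf : IsPulse f) {t : ℝ} (ht : 1 ≤ t) :
    f (2 ^ i * t) = 0 :=
  hf.eq_zero fun h => by
    linarith [h.2, one_le_mul_of_one_le_of_one_le (one_le_pow₀ one_le_two (n := i)) ht]

lemma clock_coe (hf : IsPulse f) {s : ℝ} (hs : s ∈ Icc (0 : ℝ) 1) :
    clock f i (s : UnitAddCircle) = f (2 ^ i * s) := by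
  rw [clock, periodize_coe]
  rcases hs.2.eq_or_lt with rfl | h
  · rw [Int.fract_one, hf.apply_two_pow_mul_of_nonpos le_rfl,
      hf.apply_two_pow_mul_of_one_le le_rfl]
  · rw [Int.fract_eq_self.2 ⟨hs.1, h⟩]

lemma hasCircleDeriv_clock (hf : IsPulse f) (i : ℕ) :
    HasCircleDeriv (clock f i) (fun a => 2 ^ i * clock (deriv f) i a) := by
  refine hasCircleDeriv_periodize (f' := fun s => 2 ^ i * deriv f (2 ^ i * s)) (fun x => ?_)
    (fun t ht => hf.apply_two_pow_mul_of_nonpos ht) (fun t ht => hf.apply_two_pow_mul_of_one_le ht)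
  simpa only [Function.comp_def, mul_one, mul_comm (deriv f _), id] using
    HasDerivAt.comp x (hf.hasDerivAt (2 ^ i * x)) ((hasDerivAt_id x).const_mul ((2 : ℝ) ^ i))

lemma continuous_clock (hf : IsPulse f) : Continuous (clock f i) :=
  (hasCircleDeriv_clock hf i).continuous

lemma clock_eq_zero (hf : IsPulse f) {a : UnitAddCircle} (ha : a ∉ activeSet i) :
    clock f i a = 0 := by
  obtain ⟨r, rfl⟩ := QuotientAddGroup.mk_surjective a
  refine hf.eq_zero fun h => ha ⟨Int.fract r, h, ?_⟩
  change ((Int.fract r : ℝ) : UnitAddCircle) = (r : UnitAddCircle)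
  rw [← Int.self_sub_floor, AddCircle.coe_sub, coe_intCast_unitAddCircle, sub_zero]

lemma abs_clock_le {K : ℝ} (hK : ∀ t, |f t| ≤ K) (a : UnitAddCircle) : |clock f i a| ≤ K := by
  obtain ⟨r, rfl⟩ := QuotientAddGroup.mk_surjective a
  exact hK _

lemma mem_Ico_of_two_pow_mul_mem_Icc {s : ℝ}
    (hs : (2 : ℝ) ^ i * s ∈ Icc (1 / 2 : ℝ) (7 / 8)) : s ∈ Ico (0 : ℝ) (0 + 1) := by
  have hpow : (1 : ℝ) ≤ 2 ^ i := one_le_pow₀ one_le_two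
  have hpos : 0 < s := by
    by_contra! hneg
    nlinarith [hs.1]
  exact ⟨hpos.le, by nlinarith [hs.2]⟩

lemma disjoint_activeSet {i j : ℕ} (hij : i ≠ j) : Disjoint (activeSet i) (activeSet j) := by
  wlog h : i < j generalizing i j
  · exact (this hij.symm (by omega)).symm
  rw [Set.disjoint_left]
  rintro a ⟨s, hs, rfl⟩ ⟨t, ht, hst⟩
  obtain rfl : t = s := (AddCircle.coe_eq_coe_iff_of_mem_Ico
    (mem_Ico_of_two_pow_mul_mem_Icc ht) (mem_Ico_of_two_pow_mul_mem_Icc hs)).1 hst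
  have hdouble : (2 : ℝ) ^ (i + 1) * t ≤ 2 ^ j * t :=
    mul_le_mul_of_nonneg_right (pow_le_pow_right₀ one_le_two h)
      (mem_Ico_of_two_pow_mul_mem_Icc hs).1
  rw [pow_succ] at hdouble
  linarith [hs.1, ht.2]

end Clock

/-- The smooth step from `0` to `1` along which the coordinate `m` of the centres moves; the
coordinate `0` moves before the others. -/
def rise {n : ℕ} (m : Fin (n + 2)) (t : ℝ) : ℝ :=
  Real.smoothTransition (16 * t - if m = 0 then 17 / 2 else 21 / 2)

/-- A pulse that agrees with `rise m` up to the time `3/4`; the centres of the balls move back to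
their starting points once the velocity is switched off, which makes them periodic in time. -/
def risePulse {n : ℕ} (m : Fin (n + 2)) (t : ℝ) : ℝ :=
  rise m t * (1 - Real.smoothTransition (16 * t - 25 / 2))

section Rise

variable {n : ℕ} (m : Fin (n + 2))

lemma contDiff_rise : ContDiff ℝ ∞ (rise m) :=
  Real.smoothTransition.contDiff.comp (by fun_prop)

lemma rise_of_le {t : ℝ} (ht : t ≤ 1 / 2) : rise m t = 0 :=
  Real.smoothTransition.zero_of_nonpos (by split_ifs <;> linarith)

lemma rise_of_ge {t : ℝ} (ht : 3 / 4 ≤ t) : rise m t = 1 :=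
  Real.smoothTransition.one_of_one_le (by split_ifs <;> linarith)

lemma rise_zero_of_ge {t : ℝ} (ht : 5 / 8 ≤ t) : rise (0 : Fin (n + 2)) t = 1 :=
  Real.smoothTransition.one_of_one_le (by simp only [if_true]; linarith)

lemma rise_of_ne_zero_of_le {m : Fin (n + 2)} (hm : m ≠ 0) {t : ℝ} (ht : t ≤ 5 / 8) :
    rise m t = 0 :=
  Real.smoothTransition.zero_of_nonpos (by simp only [hm, if_false]; linarith)

lemma rise_mem (t : ℝ) : rise m t ∈ Icc (0 : ℝ) 1 :=
  ⟨Real.smoothTransition.nonneg _, Real.smoothTransition.le_one _⟩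

lemma hasDerivAt_rise (t : ℝ) : HasDerivAt (rise m) (deriv (rise m) t) t :=
  ((contDiff_rise m).differentiable (by simp)).differentiableAt.hasDerivAt

lemma deriv_rise_eq_zero {t : ℝ} (ht : t ∉ Icc (1 / 2 : ℝ) (3 / 4)) : deriv (rise m) t = 0 := by
  rw [mem_Icc, not_and_or, not_le, not_le] at ht
  rcases ht with ht | ht
  · have hconst : rise m =ᶠ[nhds t] fun _ => 0 := by
      filter_upwards [gt_mem_nhds ht] with s hs using rise_of_le m hs.le
    rw [hconst.deriv_eq, deriv_const]
  · have hconst : rise m =ᶠ[nhds t] fun _ => 1 := by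
      filter_upwards [lt_mem_nhds ht] with s hs using rise_of_ge m hs.le
    rw [hconst.deriv_eq, deriv_const]

lemma isPulse_deriv_rise : IsPulse (deriv (rise m)) :=
  isPulse_of_contDiff (contDiff_infty_iff_deriv.1 (contDiff_rise m)).2
    (fun _ ht => deriv_rise_eq_zero m fun h => by linarith [h.1])
    fun _ ht => deriv_rise_eq_zero m fun h => by linarith [h.2]

lemma isPulse_risePulse : IsPulse (risePulse m) := by
  refine isPulse_of_contDiff ((contDiff_rise m).mul (contDiff_const.sub
    (Real.smoothTransition.contDiff.comp (by fun_prop)))) (fun t ht => ?_) fun t ht => ?_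
  · rw [risePulse, rise_of_le m ht.le, zero_mul]
  · rw [risePulse, Real.smoothTransition.one_of_one_le (by linarith), sub_self, mul_zero]

lemma risePulse_of_le {t : ℝ} (ht : t ≤ 3 / 4) : risePulse m t = rise m t := by
  rw [risePulse, Real.smoothTransition.zero_of_nonpos (by linarith), sub_zero, mul_one]

end Rise

/-! ### The profile of a translated ball -/

/-- A smooth function supported in `(-2, 2)`; the fields that translate a ball are products of
profiles. -/
abbrev IsProfile (f : ℝ → ℝ) : Prop := IsBumpOn (Metric.ball 0 2) f

/-- A smooth bump that is `1` on `[-1, 1]`. -/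
def unitBump : ContDiffBump (0 : ℝ) := ⟨1, 3 / 2, one_pos, by norm_num⟩

/-- The function `z ↦ z` on `[-1, 1]`, cut off. -/
def linearBump (z : ℝ) : ℝ := z * unitBump z

lemma isProfile_unitBump : IsProfile unitBump where
  contDiff := unitBump.contDiff
  tsupport_subset := by
    rw [unitBump.tsupport_eq]
    exact Metric.closedBall_subset_ball (by norm_num [unitBump])

lemma isProfile_linearBump : IsProfile linearBump where
  contDiff := contDiff_id.mul unitBump.contDiff
  tsupport_subset := (tsupport_mul_subset_right (f := fun z : ℝ => z) (g := unitBump)).trans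
    isProfile_unitBump.tsupport_subset

lemma unitBump_eq_one {z : ℝ} (hz : |z| < 1) : unitBump z = 1 :=
  unitBump.one_of_mem_closedBall (by simpa [unitBump] using hz.le)

lemma unitBump_eventuallyEq_one {z : ℝ} (hz : |z| < 1) :
    unitBump =ᶠ[nhds z] fun _ => (1 : ℝ) := by
  filter_upwards [continuous_abs.continuousAt.eventually (gt_mem_nhds hz)] with s hs
    using unitBump_eq_one hs

lemma deriv_unitBump_eq_zero {z : ℝ} (hz : |z| < 1) : deriv unitBump z = 0 := by
  rw [(unitBump_eventuallyEq_one hz).deriv_eq, deriv_const]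

lemma deriv_linearBump_eq_one {z : ℝ} (hz : |z| < 1) : deriv linearBump z = 1 := by
  have hid : linearBump =ᶠ[nhds z] id := by
    filter_upwards [unitBump_eventuallyEq_one hz] with s hs
    rw [linearBump, hs, mul_one, id]
  rw [hid.deriv_eq, deriv_id]

section Profiles

variable {n : ℕ}

/-- The coordinate that is paired with `k` in the stream function of the motion in direction `k`. -/
def partner (k : Fin (n + 2)) : Fin (n + 2) := if k = 0 then 1 else 0

/-- The factors of the stream function of the motion in direction `k`: near the ball it is the
coordinate `partner k`. -/
def streamProfile (k : Fin (n + 2)) : Fin (n + 2) → ℝ → ℝ :=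
  Function.update (fun _ => unitBump) (partner k) linearBump

/-- The factors of the component `k` of the field that translates a ball in direction `k`: the
derivative of the stream function in direction `partner k`. -/
def mainProfile (k : Fin (n + 2)) : Fin (n + 2) → ℝ → ℝ :=
  Function.update (streamProfile k) (partner k) (deriv (streamProfile k (partner k)))

/-- The factors of minus the component `partner k` of the field that translates a ball in
direction `k`: the derivative of the stream function in direction `k`. -/
def sideProfile (k : Fin (n + 2)) : Fin (n + 2) → ℝ → ℝ :=
  Function.update (streamProfile k) k (deriv (streamProfile k k))

lemma partner_ne (k : Fin (n + 2)) : partner k ≠ k := by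
  unfold partner
  split_ifs with h
  · rw [h]
    exact one_ne_zero
  · exact Ne.symm h

lemma isProfile_streamProfile (k m : Fin (n + 2)) : IsProfile (streamProfile k m) := by
  rcases eq_or_ne m (partner k) with rfl | h
  · simpa [streamProfile] using isProfile_linearBump
  · simpa [streamProfile, h] using isProfile_unitBump

lemma isProfile_mainProfile (k m : Fin (n + 2)) : IsProfile (mainProfile k m) :=
  isBumpOn_update_deriv (isProfile_streamProfile k) _ m

lemma isProfile_sideProfile (k m : Fin (n + 2)) : IsProfile (sideProfile k m) :=
  isBumpOn_update_deriv (isProfile_streamProfile k) _ m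

lemma update_mainProfile (k : Fin (n + 2)) :
    Function.update (mainProfile k) k (deriv (mainProfile k k))
      = Function.update (sideProfile k) (partner k) (deriv (sideProfile k (partner k))) := by
  rw [mainProfile, sideProfile, Function.update_of_ne (partner_ne k).symm,
    Function.update_of_ne (partner_ne k), Function.update_comm (partner_ne k)]

lemma mainProfile_eq_one (k m : Fin (n + 2)) {z : ℝ} (hz : |z| < 1) : mainProfile k m z = 1 := by
  rcases eq_or_ne m (partner k) with rfl | h
  · simpa [mainProfile, streamProfile] using deriv_linearBump_eq_one hz
  · simpa [mainProfile, streamProfile, h] using unitBump_eq_one hz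

lemma sideProfile_self_eq_zero (k : Fin (n + 2)) {z : ℝ} (hz : |z| < 1) :
    sideProfile k k z = 0 := by
  simpa [sideProfile, streamProfile, (partner_ne k).symm] using deriv_unitBump_eq_zero hz

/-- A common bound for the finitely many functions of one variable in the construction. -/
structure IsCommonBound (n : ℕ) (K : ℝ) : Prop where
  one_le : 1 ≤ K
  main : ∀ (k m : Fin (n + 2)) z, |mainProfile k m z| ≤ K
  deriv_main : ∀ (k m : Fin (n + 2)) z, |deriv (mainProfile k m) z| ≤ K
  side : ∀ (k m : Fin (n + 2)) z, |sideProfile k m z| ≤ K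
  deriv_side : ∀ (k m : Fin (n + 2)) z, |deriv (sideProfile k m) z| ≤ K
  deriv_rise : ∀ (m : Fin (n + 2)) t, |deriv (rise m) t| ≤ K
  deriv_deriv_rise : ∀ (m : Fin (n + 2)) t, |deriv (deriv (rise m)) t| ≤ K
  deriv_risePulse : ∀ (m : Fin (n + 2)) t, |deriv (risePulse m) t| ≤ K

lemma exists_isCommonBound (n : ℕ) : ∃ K, IsCommonBound n K := by
  have hprofile : ∀ {F : Fin (n + 2) → Fin (n + 2) → ℝ → ℝ}, (∀ k m, IsProfile (F k m)) →
      ∀ᶠ K in Filter.atTop, ∀ k m z, |F k m z| ≤ K := fun hF =>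
    Filter.eventually_all.2 fun k => Filter.eventually_all.2 fun m =>
      (hF k m).eventually_abs_le Metric.isBounded_ball
  have hpulse : ∀ {F : Fin (n + 2) → ℝ → ℝ}, (∀ m, IsPulse (F m)) →
      ∀ᶠ K in Filter.atTop, ∀ m t, |F m t| ≤ K := fun hF =>
    Filter.eventually_all.2 fun m => (hF m).eventually_abs_le (Metric.isBounded_Icc _ _)
  have hall : ∀ᶠ K in Filter.atTop, IsCommonBound n K := by
    filter_upwards [Filter.eventually_ge_atTop 1, hprofile isProfile_mainProfile,
      hprofile fun k m => (isProfile_mainProfile k m).deriv, hprofile isProfile_sideProfile,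
      hprofile fun k m => (isProfile_sideProfile k m).deriv, hpulse isPulse_deriv_rise,
      hpulse fun m => (isPulse_deriv_rise m).deriv, hpulse fun m => (isPulse_risePulse m).deriv]
      with K h₁ h₂ h₃ h₄ h₅ h₆ h₇ h₈ using ⟨h₁, h₂, h₃, h₄, h₅, h₆, h₇, h₈⟩
  exact hall.exists

end Profiles

/-! ### The generations of moving balls -/

section Field

variable {n : ℕ} (N : ℕ) (η : ℝ) (i : ℕ)

/-- The labels of the balls that move in one cell: the digits of their starting point, and their
family. -/
abbrev Label (n N : ℕ) : Type := (Fin (n + 2) → Fin N) × Fin 2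

/-- The distance between neighbouring balls of the `i`-th generation after the contraction, relative
to the size of the cell. -/
def gap : ℝ := η * (η * N) ^ i

/-- The total displacement of a ball of the `i`-th generation, relative to the size of the cell. -/
def displacement (q : Label n N) (m : Fin (n + 2)) : ℝ :=
  (gap N η i - 1 / N) * ((q.1 m : ℕ) : ℝ) + ((q.2 : ℕ) : ℝ) / 2 * (1 - 1 / N)

/-- The centre of a ball of the `i`-th generation, relative to the size of the cell, when the
fraction `θ` of the displacement is done. -/
def centre (q : Label n N) (m : Fin (n + 2)) (θ : ℝ) : ℝ :=
  (((q.1 m : ℕ) : ℝ) + ((q.2 : ℕ) : ℝ) / 2) / N + θ * displacement N η i q m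

/-- The centre as a function of the periodic time. -/
def centreClock (q : Label n N) (m : Fin (n + 2)) (a : UnitAddCircle) : ℝ :=
  centre N η i q m (clock (risePulse m) i a)

/-- The derivative of `centreClock`. -/
def centreClockDeriv (q : Label n N) (m : Fin (n + 2)) (a : UnitAddCircle) : ℝ :=
  displacement N η i q m * (2 ^ i * clock (deriv (risePulse m)) i a)

/-- The block with the factors `f` around the ball `q`, while the ball moves in direction `k`. -/
def movingBlock (q : Label n N) (k : Fin (n + 2)) (f : Fin (n + 2) → ℝ → ℝ) :
    Torus (n + 3) → ℝ :=
  block (clock (deriv (rise k)) i) (centreClock N η i q) f (gap N η i / 4) (N ^ i)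

/-- The partial derivatives of `movingBlock`. -/
def movingBlockDeriv (q : Label n N) (k : Fin (n + 2)) (f : Fin (n + 2) → ℝ → ℝ) :
    Fin (n + 3) → Torus (n + 3) → ℝ :=
  blockDeriv (clock (deriv (rise k)) i) (fun a => 2 ^ i * clock (deriv (deriv (rise k))) i a)
    (centreClock N η i q) (centreClockDeriv N η i q) f (gap N η i / 4) (N ^ i)

/-- The component `j` of the divergence-free field that moves the ball `q` in direction `k`, up to
the speed factor of the generation. -/
def ballField (q : Label n N) (k : Fin (n + 2)) (j : Fin (n + 3)) (x : Torus (n + 3)) : ℝ :=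
  displacement N η i q k *
    ((if j = k.succ then 1 else 0) * movingBlock N η i q k (mainProfile k) x
      + (if j = (partner k).succ then -1 else 0) * movingBlock N η i q k (sideProfile k) x)

/-- The partial derivatives of `ballField`. -/
def ballFieldDeriv (q : Label n N) (k : Fin (n + 2)) (j l : Fin (n + 3)) (x : Torus (n + 3)) : ℝ :=
  displacement N η i q k *
    ((if j = k.succ then 1 else 0) * movingBlockDeriv N η i q k (mainProfile k) l x
      + (if j = (partner k).succ then -1 else 0) * movingBlockDeriv N η i q k (sideProfile k) l x)

/-- The component `j` of the velocity field of the `i`-th generation. -/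
def generation (j : Fin (n + 3)) (x : Torus (n + 3)) : ℝ :=
  (2 / N) ^ i * ∑ q : Label n N, ∑ k : Fin (n + 2), ballField N η i q k j x

/-- The partial derivatives of `generation`. -/
def generationDeriv (j l : Fin (n + 3)) (x : Torus (n + 3)) : ℝ :=
  (2 / N) ^ i * ∑ q : Label n N, ∑ k : Fin (n + 2), ballFieldDeriv N η i q k j l x

/-- A set outside of which the derivatives of the `i`-th generation vanish. -/
def generationSupport (n : ℕ) : Set (Torus (n + 3)) :=
  ⋃ q : Label n N, blockSupport (activeSet i) (centreClock N η i q) (2 * (gap N η i / 4)) (N ^ i)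

variable {N η i}

lemma generation_zero (x : Torus (n + 3)) : generation N η i 0 x = 0 := by
  simp [generation, ballField, (Fin.succ_ne_zero _).symm]

lemma movingBlockDeriv_succ (q : Label n N) (k m : Fin (n + 2)) (f : Fin (n + 2) → ℝ → ℝ)
    (x : Torus (n + 3)) :
    movingBlockDeriv N η i q k f m.succ x = (N ^ i : ℕ) / (gap N η i / 4) *
      movingBlock N η i q k (Function.update f m (deriv (f m))) x := by
  simp [movingBlockDeriv, movingBlock, blockDeriv, offsetDeriv, ite_div, ite_mul]

-- The main and the side profile are the derivatives of one stream function in the directions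
-- `partner k` and `k`, so that the two terms are mixed second derivatives which cancel.
lemma sum_ballFieldDeriv (q : Label n N) (k : Fin (n + 2)) (x : Torus (n + 3)) :
    ∑ j, ballFieldDeriv N η i q k j j x = 0 := by
  have hmixed : movingBlockDeriv N η i q k (mainProfile k) k.succ x
      = movingBlockDeriv N η i q k (sideProfile k) (partner k).succ x := by
    rw [movingBlockDeriv_succ, movingBlockDeriv_succ, update_mainProfile]
  simp [ballFieldDeriv, ← Finset.mul_sum, Finset.sum_add_distrib, hmixed]

lemma sum_generationDeriv (x : Torus (n + 3)) : ∑ j, generationDeriv N η i j j x = 0 := by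
  simp only [generationDeriv]
  rw [← Finset.mul_sum, Finset.sum_comm]
  simp only [Finset.sum_comm (s := Finset.univ (α := Fin (n + 3))), sum_ballFieldDeriv,
    Finset.sum_const_zero, mul_zero]

lemma gap_pos (hN : 0 < N) (hη : 0 < η) : 0 < gap N η i := by
  unfold gap
  positivity

lemma gap_le (hη : 0 ≤ η) (hηN : η * N ≤ 1) : gap N η i ≤ η :=
  mul_le_of_le_one_right hη (pow_le_one₀ (by positivity) hηN)

lemma abs_displacement_le (hη : 0 ≤ η) (hηN : η * N ≤ 1) (q : Label n N) (m : Fin (n + 2)) :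
    |displacement N η i q m| ≤ 2 := by
  have hN : (0 : ℝ) < N := Nat.cast_pos.2 (q.1 m).pos
  have hdigit : ((q.1 m : ℕ) : ℝ) ≤ N := Nat.cast_le.2 (q.1 m).2.le
  have hfamily : ((q.2 : ℕ) : ℝ) ≤ 1 := by
    exact_mod_cast (by omega : (q.2 : ℕ) ≤ 1)
  have hgap₀ : 0 ≤ gap N η i := by
    unfold gap
    positivity
  have hgap : gap N η i * ((q.1 m : ℕ) : ℝ) ≤ 1 :=
    (mul_le_mul (gap_le hη hηN) hdigit (Nat.cast_nonneg _) hη).trans hηN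
  have hcell : 1 / (N : ℝ) * ((q.1 m : ℕ) : ℝ) ≤ 1 := by
    rwa [one_div, inv_mul_le_iff₀ hN, mul_one]
  have hN₁ : 1 / (N : ℝ) ≤ 1 := by
    rw [div_le_one hN]
    exact_mod_cast (q.1 m).pos
  have hN₀ : 0 ≤ 1 / (N : ℝ) := by positivity
  unfold displacement
  rw [abs_le]
  constructor <;> nlinarith [mul_nonneg hN₀ (Nat.cast_nonneg (α := ℝ) (q.1 m)),
    mul_nonneg hgap₀ (Nat.cast_nonneg (α := ℝ) (q.1 m)), Nat.cast_nonneg (α := ℝ) (q.2 : ℕ)]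

lemma hasCircleDeriv_centreClock (q : Label n N) (m : Fin (n + 2)) :
    HasCircleDeriv (centreClock N η i q m) (centreClockDeriv N η i q m) := by
  intro x
  have hclock := (hasCircleDeriv_clock (isPulse_risePulse m) i x).mul_const (displacement N η i q m)
  simpa only [centreClock, centre, centreClockDeriv, mul_comm (displacement N η i q m)] using
    hclock.const_add ((((q.1 m : ℕ) : ℝ) + ((q.2 : ℕ) : ℝ) / 2) / N)

lemma continuous_centreClockDeriv (q : Label n N) (m : Fin (n + 2)) :
    Continuous (centreClockDeriv N η i q m) :=
  ((continuous_clock (isPulse_risePulse m).deriv).const_mul _).const_mul _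

lemma abs_centreClockDeriv_le (hη : 0 ≤ η) (hηN : η * N ≤ 1) {K : ℝ} (hK : IsCommonBound n K)
    (q : Label n N) (m : Fin (n + 2)) (a : UnitAddCircle) :
    |centreClockDeriv N η i q m a| ≤ 2 * (2 ^ i * K) := by
  rw [centreClockDeriv, abs_mul, abs_mul, abs_of_pos (by positivity : (0 : ℝ) < 2 ^ i)]
  gcongr
  exacts [abs_displacement_le hη hηN q m, abs_clock_le (hK.deriv_risePulse m) a]

lemma disjoint_generationSupport :
    Pairwise (Function.onFun Disjoint fun i => generationSupport N η i n) := by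
  intro i j hij
  rw [Function.onFun, Set.disjoint_left]
  intro x hx hx'
  obtain ⟨q, hq⟩ := mem_iUnion.1 hx
  obtain ⟨q', hq'⟩ := mem_iUnion.1 hx'
  exact Set.disjoint_left.1 (disjoint_activeSet hij) hq.1 hq'.1

lemma volume_generationSupport_le (hN : 0 < N) (hη : 0 < η) :
    volume (generationSupport N η i n) ≤
      ENNReal.ofReal (Fintype.card (Label n N) * η ^ (n + 2) * ((η * N) ^ (n + 2)) ^ i) := by
  have hgap := gap_pos (i := i) hN hη
  refine (measure_iUnion_fintype_le _ _).trans ?_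
  calc ∑ q : Label n N, volume (blockSupport (activeSet i) (centreClock N η i q)
        (2 * (gap N η i / 4)) (N ^ i))
      ≤ ∑ _q : Label n N, ENNReal.ofReal ((2 * (2 * (gap N η i / 4))) ^ (n + 2)) :=
        Finset.sum_le_sum fun q _ => volume_blockSupport_le _
          (fun m => (hasCircleDeriv_centreClock q m).continuous) (by positivity) (by positivity)
    _ = ENNReal.ofReal (Fintype.card (Label n N) * gap N η i ^ (n + 2)) := by
        rw [Finset.sum_const, Finset.card_univ, nsmul_eq_mul, ← ENNReal.ofReal_natCast,
          ← ENNReal.ofReal_mul (by positivity)]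
        ring_nf
    _ = _ := by rw [gap, mul_pow, pow_right_comm, mul_assoc]

/-- The constant in the bounds for the moving blocks, in terms of a common bound `K` for their
factors. -/
def blockBound (n : ℕ) (η K : ℝ) : ℝ := K * K ^ (n + 2) * (1 + (n + 2) * (8 * K / η))

lemma slope_le_blockBound_mul (hN : 0 < N) (hη : 0 < η) (hη₂ : η ≤ 1 / 2) {K : ℝ} (hK : 0 ≤ K)
    (i : ℕ) :
    2 ^ i * K * K ^ (n + 2) + (n + 2 : ℕ) * (2 * (N ^ i * K) / (gap N η i / 4) * (K * K ^ (n + 2)))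
      ≤ blockBound n η K * (1 / η) ^ i := by
  have hscale : (N : ℝ) ^ i / gap N η i = 1 / η * (1 / η) ^ i := by
    rw [gap, mul_pow, one_div_pow]
    field_simp
  have htwo : (2 : ℝ) ^ i ≤ (1 / η) ^ i := by
    gcongr
    rwa [le_one_div two_pos hη]
  calc 2 ^ i * K * K ^ (n + 2)
        + (n + 2 : ℕ) * (2 * (N ^ i * K) / (gap N η i / 4) * (K * K ^ (n + 2)))
      = K * K ^ (n + 2) * (2 ^ i + (n + 2) * (8 * K * (N ^ i / gap N η i))) := by
        push_cast
        ring
    _ ≤ K * K ^ (n + 2) * ((1 / η) ^ i + (n + 2) * (8 * K * (1 / η * (1 / η) ^ i))) := by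
        rw [hscale]
        gcongr
    _ = blockBound n η K * (1 / η) ^ i := by
        rw [blockBound]
        ring

lemma isLocalized_movingBlock (hN : 2 ≤ N) (hη : 0 < η) (hηN : η * N ≤ 1) {K : ℝ}
    (hK : IsCommonBound n K) (q : Label n N) (k : Fin (n + 2)) {f : Fin (n + 2) → ℝ → ℝ}
    (hf : ∀ m, IsProfile (f m)) (hfK : ∀ m z, |f m z| ≤ K) (hfK' : ∀ m z, |deriv (f m) z| ≤ K) :
    IsLocalized (movingBlock N η i q k f) (movingBlockDeriv N η i q k f) (blockBound n η K)
      (blockBound n η K * (1 / η) ^ i) (generationSupport N η i n) := by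
  have hK₀ : 0 ≤ K := zero_le_one.trans hK.one_le
  have hN₂ : (2 : ℝ) ≤ N := by exact_mod_cast hN
  have hη₂ : η ≤ 1 / 2 := by nlinarith
  have hgap := gap_pos (N := N) (i := i) (by omega) hη
  have hdouble : 2 * (2 ^ i * K) ≤ 2 * (N ^ i * K) := by gcongr
  refine (isLocalized_block (hasCircleDeriv_clock (isPulse_deriv_rise k) i)
    ((continuous_clock (isPulse_deriv_rise k).deriv).const_mul _)
    (hasCircleDeriv_centreClock q) (continuous_centreClockDeriv q) hf
    (by positivity) (by linarith [gap_le (i := i) hη.le hηN])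
    (fun a => clock_eq_zero (isPulse_deriv_rise k))
    (fun a ha => by rw [clock_eq_zero (isPulse_deriv_rise k).deriv ha, mul_zero])
    (abs_clock_le (hK.deriv_rise k)) (A' := 2 ^ i * K) (fun a => ?_)
    (fun m a => (abs_centreClockDeriv_le hη.le hηN hK q m a).trans hdouble) ?_ hfK hfK').mono
    ?_ ?_ (subset_iUnion (fun q : Label n N => blockSupport (activeSet i) (centreClock N η i q)
      (2 * (gap N η i / 4)) (N ^ i)) q)
  · rw [abs_mul, abs_of_pos (by positivity : (0 : ℝ) < 2 ^ i)]
    gcongr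
    exact abs_clock_le (hK.deriv_deriv_rise k) a
  · push_cast
    nlinarith [hK.one_le, pow_nonneg (zero_le_two.trans hN₂) i]
  · exact le_mul_of_one_le_right (by positivity) (le_add_of_nonneg_right (by positivity))
  · exact slope_le_blockBound_mul (by omega) hη hη₂ hK₀ i

lemma isLocalized_ballField (hN : 2 ≤ N) (hη : 0 < η) (hηN : η * N ≤ 1) {K : ℝ}
    (hK : IsCommonBound n K) (q : Label n N) (k : Fin (n + 2)) (j : Fin (n + 3)) :
    IsLocalized (ballField N η i q k j) (ballFieldDeriv N η i q k j) (4 * blockBound n η K)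
      (4 * blockBound n η K * (1 / η) ^ i) (generationSupport N η i n) := by
  have hmain := (isLocalized_movingBlock (i := i) hN hη hηN hK q k (isProfile_mainProfile k)
    (hK.main k) (hK.deriv_main k)).const_mul (if j = k.succ then 1 else 0)
  have hside := (isLocalized_movingBlock (i := i) hN hη hηN hK q k (isProfile_sideProfile k)
    (hK.side k) (hK.deriv_side k)).const_mul (if j = (partner k).succ then -1 else 0)
  have hmain₁ : |if j = k.succ then (1 : ℝ) else 0| ≤ 1 := by split_ifs <;> simp
  have hside₁ : |if j = (partner k).succ then (-1 : ℝ) else 0| ≤ 1 := by split_ifs <;> simp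
  have hD : 0 ≤ blockBound n η K :=
    (isLocalized_movingBlock (i := i) hN hη hηN hK q k (isProfile_mainProfile k)
      (hK.main k) (hK.deriv_main k)).amplitude_nonneg
  have hcombine : ∀ {E a b : ℝ}, 0 ≤ E → |a| ≤ 1 → |b| ≤ 1 →
      |displacement N η i q k| * (|a| * E + |b| * E) ≤ 4 * E := fun {E a b} hE ha hb => by
    calc |displacement N η i q k| * (|a| * E + |b| * E)
        ≤ 2 * (1 * E + 1 * E) := by
          gcongr
          exact abs_displacement_le hη.le hηN q k
      _ = 4 * E := by ring
  refine ((hmain.add hside).const_mul (displacement N η i q k)).mono (hcombine hD hmain₁ hside₁)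
    ?_ subset_rfl
  rw [mul_assoc]
  exact hcombine (by positivity) hmain₁ hside₁

lemma exists_isGeometric_generation (n : ℕ) (hN : 3 ≤ N) (hη : 0 < η) (hηN : η * N ≤ 1) :
    ∃ C : ℝ, ∀ j : Fin (n + 3), IsGeometric (fun i => generation N η i j)
      (fun i => generationDeriv N η i j) (fun i => generationSupport N η i n) C
      (2 / N) (2 / (N * η)) ((η * N) ^ (n + 2)) := by
  obtain ⟨K, hK⟩ := exists_isCommonBound n
  have hN₃ : (3 : ℝ) ≤ N := by exact_mod_cast hN
  have hN₀ : (0 : ℝ) < N := by linarith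
  have hK₀ : 0 ≤ K := zero_le_one.trans hK.one_le
  set C₁ : ℝ := Fintype.card (Label n N) * ((n + 2 : ℕ) * (4 * blockBound n η K)) with hC₁
  set C₂ : ℝ := Fintype.card (Label n N) * η ^ (n + 2)
  have hC₁₀ : 0 ≤ C₁ := by
    rw [hC₁, blockBound]
    positivity
  have hC₂₀ : 0 ≤ C₂ := by positivity
  refine ⟨C₁ + C₂, fun j => ⟨by positivity, ?_, ?_, by positivity, fun i => ?_,
    disjoint_generationSupport, fun i => ?_⟩⟩
  · rw [div_lt_one hN₀]
    linarith
  · rw [le_div_iff₀ (by positivity)]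
    linarith
  · have hsum := (IsLocalized.sum (s := Finset.univ) fun q _ => IsLocalized.sum (s := Finset.univ)
      fun k _ => isLocalized_ballField (n := n) (i := i) (by omega) hη hηN hK q k j).const_mul
        ((2 / N : ℝ) ^ i)
    simp only [Finset.sum_const, Finset.card_univ, nsmul_eq_mul, Fintype.card_fin] at hsum
    rw [abs_of_nonneg (by positivity)] at hsum
    refine hsum.mono ?_ ?_ subset_rfl
    · rw [← hC₁, mul_comm]
      gcongr
      linarith
    · calc _ = C₁ * (2 / (N * η)) ^ i := by
            rw [hC₁, ← div_div, div_eq_mul_one_div _ η, mul_pow]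
            ring
        _ ≤ (C₁ + C₂) * (2 / (N * η)) ^ i := by
            gcongr
            linarith
  · refine (volume_generationSupport_le (by omega) hη).trans (ENNReal.ofReal_le_ofReal ?_)
    gcongr
    linarith

end Field

/-! ### Separation of the balls -/

section Separation

lemma le_norm_coe_unitAddCircle {δ z : ℝ} (h₀ : δ ≤ |z|) (h₁ : |z| ≤ 1 - δ) :
    δ ≤ ‖(z : UnitAddCircle)‖ := by
  rw [UnitAddCircle.norm_eq]
  rcases eq_or_ne (round z) 0 with h | h
  · rwa [h, Int.cast_zero, sub_zero]
  · have hround : (1 : ℝ) ≤ |(round z : ℝ)| := by exact_mod_cast Int.one_le_abs h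
    rw [abs_sub_comm]
    linarith [abs_sub_abs_le_abs_sub (round z : ℝ) z]

variable {n N : ℕ} {η : ℝ} {i : ℕ} {q q' : Label n N} {m : Fin (n + 2)} {θ : ℝ}

lemma centre_sub_centre (q q' : Label n N) (m : Fin (n + 2)) (θ : ℝ) :
    centre N η i q m θ - centre N η i q' m θ
      = (((q.1 m : ℕ) : ℝ) - (q'.1 m : ℕ)) * (1 / N + θ * (gap N η i - 1 / N))
        + (((q.2 : ℕ) : ℝ) - (q'.2 : ℕ)) / 2 * (1 / N + θ * (1 - 1 / N)) := by
  unfold centre displacement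
  ring

lemma gap_mul_le {δ : ℝ} (hη : 0 ≤ η) (hηN : η * N ≤ δ) (hδ : δ ≤ 1) : gap N η i * N ≤ δ :=
  (mul_le_mul_of_nonneg_right (gap_le hη (hηN.trans hδ)) N.cast_nonneg).trans hηN

lemma abs_digit_sub_le (q q' : Label n N) (m : Fin (n + 2)) :
    |((q.1 m : ℕ) : ℝ) - (q'.1 m : ℕ)| ≤ N - 1 := by
  have hle : ∀ q : Label n N, ((q.1 m : ℕ) : ℝ) + 1 ≤ N := fun q => by
    exact_mod_cast (q.1 m).2
  rw [abs_le]
  constructor <;> linarith [hle q, hle q', (q.1 m : ℕ).cast_nonneg (α := ℝ),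
    (q'.1 m : ℕ).cast_nonneg (α := ℝ)]

lemma one_le_abs_natCast_sub {a b : ℕ} (h : a ≠ b) : (1 : ℝ) ≤ |(a : ℝ) - b| := by
  exact_mod_cast Int.one_le_abs (sub_ne_zero.2 (Nat.cast_injective.ne h : (a : ℤ) ≠ b))

lemma gap_le_norm_centre_sub_of_digit_ne (hη : 0 < η) (hηN : η * N ≤ 1) (hfamily : q.2 = q'.2)
    (hdigit : q.1 m ≠ q'.1 m) (hθ : θ ∈ Icc (0 : ℝ) 1) :
    gap N η i ≤ ‖((centre N η i q m θ - centre N η i q' m θ : ℝ) : UnitAddCircle)‖ := by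
  have hN : (0 : ℝ) < N := Nat.cast_pos.2 (q.1 m).pos
  have hgap₀ : 0 < gap N η i := gap_pos (q.1 m).pos hη
  have hgap₁ : gap N η i ≤ 1 / N := (le_div_iff₀ hN).2 (gap_mul_le hη.le hηN le_rfl)
  set σ : ℝ := 1 / N + θ * (gap N η i - 1 / N)
  have hσ₁ : σ ≤ 1 / N := by nlinarith [hθ.1]
  have hσ₀ : gap N η i ≤ σ := by nlinarith [hθ.2]
  have hdiff : |centre N η i q m θ - centre N η i q' m θ|
      = |((q.1 m : ℕ) : ℝ) - (q'.1 m : ℕ)| * σ := by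
    rw [centre_sub_centre, hfamily, sub_self, zero_div, zero_mul, add_zero, abs_mul,
      abs_of_pos (hgap₀.trans_le hσ₀)]
  have hN₁ : (N - 1 : ℝ) * (1 / N) = 1 - 1 / N := by field_simp
  refine le_norm_coe_unitAddCircle ?_ ?_ <;> rw [hdiff]
  · nlinarith [one_le_abs_natCast_sub fun h => hdigit (Fin.ext h)]
  · linarith [mul_le_mul (abs_digit_sub_le q q' m) hσ₁ (hgap₀.trans_le hσ₀).le
      ((abs_nonneg _).trans (abs_digit_sub_le q q' m))]

lemma abs_family_sub_div_two (hfamily : q.2 ≠ q'.2) :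
    |(((q.2 : ℕ) : ℝ) - (q'.2 : ℕ)) / 2| = 1 / 2 := by
  rw [abs_div, abs_two]
  congr 1
  obtain ⟨a, b⟩ := q
  obtain ⟨a', b'⟩ := q'
  fin_cases b <;> fin_cases b' <;> simp_all

lemma gap_le_norm_centre_sub_of_family_ne_of_eq_one (hη : 0 < η) (hηN : η * N ≤ 1 / 2)
    (hfamily : q.2 ≠ q'.2) :
    gap N η i ≤ ‖((centre N η i q m 1 - centre N η i q' m 1 : ℝ) : UnitAddCircle)‖ := by
  have hgap₀ : 0 < gap N η i := gap_pos (q.1 m).pos hη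
  have hgap := gap_mul_le (i := i) hη.le hηN (by norm_num)
  have hdiff : centre N η i q m 1 - centre N η i q' m 1
      = (((q.1 m : ℕ) : ℝ) - (q'.1 m : ℕ)) * gap N η i
        + (((q.2 : ℕ) : ℝ) - (q'.2 : ℕ)) / 2 := by
    rw [centre_sub_centre]
    ring
  have hdigits : |(((q.1 m : ℕ) : ℝ) - (q'.1 m : ℕ)) * gap N η i| ≤ 1 / 2 - gap N η i := by
    rw [abs_mul, abs_of_pos hgap₀]
    nlinarith [abs_digit_sub_le q q' m]
  have hhalf := abs_family_sub_div_two hfamily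
  refine le_norm_coe_unitAddCircle ?_ ?_ <;> rw [hdiff, add_comm]
  · linarith [abs_sub_abs_le_abs_add ((((q.2 : ℕ) : ℝ) - (q'.2 : ℕ)) / 2)
      ((((q.1 m : ℕ) : ℝ) - (q'.1 m : ℕ)) * gap N η i)]
  · linarith [abs_add_le ((((q.2 : ℕ) : ℝ) - (q'.2 : ℕ)) / 2)
      ((((q.1 m : ℕ) : ℝ) - (q'.1 m : ℕ)) * gap N η i)]

lemma gap_le_norm_centre_sub_of_family_ne_of_eq_zero (hη : 0 < η) (hηN : η * N ≤ 1 / 2)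
    (hfamily : q.2 ≠ q'.2) :
    gap N η i ≤ ‖((centre N η i q m 0 - centre N η i q' m 0 : ℝ) : UnitAddCircle)‖ := by
  have hN : (0 : ℝ) < N := Nat.cast_pos.2 (q.1 m).pos
  have hgap : gap N η i ≤ 1 / 2 / N :=
    (le_div_iff₀ hN).2 (gap_mul_le hη.le hηN (by norm_num))
  have hdiff : centre N η i q m 0 - centre N η i q' m 0
      = ((((q.1 m : ℕ) : ℝ) - (q'.1 m : ℕ)) + (((q.2 : ℕ) : ℝ) - (q'.2 : ℕ)) / 2) / N := by
    rw [centre_sub_centre]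
    ring
  have hhalf := abs_family_sub_div_two hfamily
  have hsub : (1 - 1 / 2 / N : ℝ) = (N - 1 / 2) / N := by field_simp
  have habs := abs_add_le (((q.1 m : ℕ) : ℝ) - (q'.1 m : ℕ)) ((((q.2 : ℕ) : ℝ) - (q'.2 : ℕ)) / 2)
  refine le_trans hgap (le_norm_coe_unitAddCircle ?_ ?_) <;> rw [hdiff, abs_div, abs_of_pos hN]
  · refine div_le_div_of_nonneg_right ?_ hN.le
    rcases eq_or_ne (q.1 m) (q'.1 m) with hdigit | hdigit
    · rw [hdigit, sub_self, zero_add, hhalf]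
    · linarith [one_le_abs_natCast_sub fun h => hdigit (Fin.ext h),
        abs_sub_abs_le_abs_add (((q.1 m : ℕ) : ℝ) - (q'.1 m : ℕ))
          ((((q.2 : ℕ) : ℝ) - (q'.2 : ℕ)) / 2)]
  · rw [hsub]
    refine div_le_div_of_nonneg_right ?_ hN.le
    linarith [abs_digit_sub_le q q' m]

lemma exists_gap_le_norm_centre_sub (hη : 0 < η) (hηN : η * N ≤ 1 / 2) (hq : q ≠ q')
    {θ : Fin (n + 2) → ℝ} (hθ : ∀ m, θ m ∈ Icc (0 : ℝ) 1) (hθ' : θ 0 = 1 ∨ θ 1 = 0) :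
    ∃ m, gap N η i ≤ ‖((centre N η i q m (θ m) - centre N η i q' m (θ m) : ℝ) :
      UnitAddCircle)‖ := by
  by_cases hfamily : q.2 = q'.2
  · obtain ⟨m, hm⟩ : ∃ m, q.1 m ≠ q'.1 m := by
      by_contra! hdigits
      exact hq (Prod.ext (funext hdigits) hfamily)
    exact ⟨m, gap_le_norm_centre_sub_of_digit_ne hη (by linarith) hfamily hm (hθ m)⟩
  · rcases hθ' with h | h
    · refine ⟨0, ?_⟩
      rw [h]
      exact gap_le_norm_centre_sub_of_family_ne_of_eq_one hη hηN hfamily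
    · refine ⟨1, ?_⟩
      rw [h]
      exact gap_le_norm_centre_sub_of_family_ne_of_eq_zero hη hηN hfamily

end Separation

/-! ### The explicit trajectories -/

section Path

variable {n N : ℕ} {η : ℝ}

lemma exists_hasSum_digits (hN : 2 ≤ N) (x : ℝ) :
    ∃ D : ℕ → Fin N, HasSum (fun j => ((D j : ℕ) : ℝ) / N ^ (j + 1)) (Int.fract x) := by
  have : NeZero N := ⟨by omega⟩
  refine ⟨Real.digits (Int.fract x) N, ?_⟩
  simp only [div_eq_mul_inv]
  exact Real.hasSum_ofDigitsTerm_digits (Int.fract x) hN ⟨Int.fract_nonneg x, Int.fract_lt_one x⟩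

lemma exists_hasSum_pow_mul_digits (hη : 0 < η) (hηN : η * N ≤ 1 / 8) (D : ℕ → Fin N) :
    ∃ τ ∈ Ico (0 : ℝ) (1 / 4), HasSum (fun r => η ^ (r + 1) * ((D r : ℕ) : ℝ)) τ := by
  have hN : (1 : ℝ) ≤ N := by exact_mod_cast (D 0).pos
  have hη₁ : η ≤ 1 / 8 := by nlinarith
  have hle : ∀ r, η ^ (r + 1) * ((D r : ℕ) : ℝ) ≤ 1 / 8 * η ^ r := fun r => by
    have hdigit : ((D r : ℕ) : ℝ) ≤ N := by exact_mod_cast (D r).2.le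
    calc η ^ (r + 1) * ((D r : ℕ) : ℝ) ≤ η ^ (r + 1) * N := by gcongr
      _ = η * N * η ^ r := by ring
      _ ≤ 1 / 8 * η ^ r := by gcongr
  have hnonneg : ∀ r, 0 ≤ η ^ (r + 1) * ((D r : ℕ) : ℝ) := fun r => by positivity
  have hgeometric := (hasSum_geometric_of_lt_one hη.le (by linarith)).mul_left (1 / 8)
  have hsum := (Summable.of_nonneg_of_le hnonneg hle hgeometric.summable).hasSum
  refine ⟨_, ⟨hsum.nonneg hnonneg, (hasSum_le hle hsum hgeometric).trans_lt ?_⟩, hsum⟩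
  rw [← div_eq_mul_inv, div_lt_iff₀ (by linarith)]
  linarith

/-- The coordinate `m` of the trajectory that follows the balls with the labels `L`, from the point
`x` at time `0`. -/
def path (N : ℕ) (η : ℝ) (L : ℕ → Label n N) (m : Fin (n + 2)) (x s : ℝ) : ℝ :=
  x + ∑' j, rise m (2 ^ j * s) * (displacement N η j (L j) m / N ^ j)

/-- The labels `L` belong to the family `b` and their digits are the base `N` digits of the
coordinates of `x` modulo `1`, so that the balls `L i` carry the point `x` one after another, the
fine generations first. -/
structure IsExpansion (b : Fin 2) (x : Fin (n + 2) → ℝ) (L : ℕ → Label n N) : Prop where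
  family : ∀ j, (L j).2 = b
  hasSum_digits : ∀ m, HasSum (fun j => (((L j).1 m : ℕ) : ℝ) / N ^ (j + 1)) (Int.fract (x m))

lemma exists_isExpansion (hN : 2 ≤ N) (x : Fin (n + 2) → ℝ) :
    ∃ D : ℕ → Fin (n + 2) → Fin N, ∀ b, IsExpansion b x fun j => (D j, b) := by
  choose D hD using fun m => exists_hasSum_digits hN (x m)
  exact ⟨fun j m => D m j, fun _ => ⟨fun _ => rfl, hD⟩⟩

variable {L : ℕ → Label n N} {m : Fin (n + 2)}

lemma summable_path (hN : 2 ≤ N) (hη : 0 ≤ η) (hηN : η * N ≤ 1) (m : Fin (n + 2)) (s : ℝ) :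
    Summable fun j => rise m (2 ^ j * s) * (displacement N η j (L j) m / N ^ j) := by
  have hN' : (1 : ℝ) < N := by exact_mod_cast hN
  refine Summable.of_norm_bounded (g := fun j => 2 * (1 / (N : ℝ)) ^ j)
    ((summable_geometric_of_lt_one (by positivity) ((div_lt_one (by linarith)).2 hN')).mul_left 2)
    fun j => ?_
  have hpow : (0 : ℝ) < (N : ℝ) ^ j := by positivity
  calc ‖rise m (2 ^ j * s) * (displacement N η j (L j) m / N ^ j)‖
      = rise m (2 ^ j * s) * (|displacement N η j (L j) m| / N ^ j) := by
        rw [Real.norm_eq_abs, abs_mul, abs_of_nonneg (rise_mem m _).1, abs_div, abs_of_pos hpow]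
    _ ≤ 1 * (2 / N ^ j) := by
        gcongr
        exacts [(rise_mem m _).2, abs_displacement_le hη hηN _ m]
    _ = 2 * (1 / (N : ℝ)) ^ j := by ring

lemma path_zero (L : ℕ → Label n N) (m : Fin (n + 2)) (x : ℝ) : path N η L m x 0 = x := by
  simp [path, rise_of_le m (by norm_num : (0 : ℝ) ≤ 1 / 2)]

lemma hasDerivAt_path_summand (q : Label n N) (m : Fin (n + 2)) (j : ℕ) (s : ℝ) :
    HasDerivAt (fun s => rise m (2 ^ j * s) * (displacement N η j q m / N ^ j))
      ((2 / N) ^ j * (deriv (rise m) (2 ^ j * s) * displacement N η j q m)) s := by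
  have hrise := HasDerivAt.comp s (hasDerivAt_rise m (2 ^ j * s))
    ((hasDerivAt_id s).const_mul ((2 : ℝ) ^ j))
  refine (hrise.mul_const (displacement N η j q m / N ^ j)).congr_deriv ?_
  rw [div_pow]
  ring

lemma hasDerivAt_path (hN : 3 ≤ N) (hη : 0 ≤ η) (hηN : η * N ≤ 1) (m : Fin (n + 2)) (x s : ℝ) :
    HasDerivAt (path N η L m x)
      (∑' j, (2 / N) ^ j * (deriv (rise m) (2 ^ j * s) * displacement N η j (L j) m)) s := by
  have hN' : (3 : ℝ) ≤ N := by exact_mod_cast hN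
  obtain ⟨K, hK⟩ := (((isPulse_deriv_rise m).eventually_abs_le (Metric.isBounded_Icc _ _)).and
    (Filter.eventually_ge_atTop 0)).exists
  have hbound : ∀ (j : ℕ) (s : ℝ),
      ‖(2 / N : ℝ) ^ j * (deriv (rise m) (2 ^ j * s) * displacement N η j (L j) m)‖
        ≤ (2 / (N : ℝ)) ^ j * (K * 2) := fun j s => by
    rw [norm_mul, norm_mul, Real.norm_of_nonneg (by positivity), Real.norm_eq_abs, Real.norm_eq_abs]
    gcongr
    exacts [hK.2, hK.1 _, abs_displacement_le hη hηN _ m]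
  have hsum : Summable fun j => (2 / (N : ℝ)) ^ j * (K * 2) :=
    (summable_geometric_of_lt_one (by positivity)
      ((div_lt_one (by linarith)).2 (by linarith))).mul_right _
  exact (hasDerivAt_tsum hsum (fun j => hasDerivAt_path_summand (L j) m j) hbound
    (summable_path (by omega) hη hηN m 0) s).const_add x

/-- The contribution of the `j`-th digit of the starting point and of the `j`-th ball to a path. -/
def pathTerm (N : ℕ) (η : ℝ) (L : ℕ → Label n N) (m : Fin (n + 2)) (s : ℝ) (j : ℕ) : ℝ :=
  (((L j).1 m : ℕ) : ℝ) / N ^ (j + 1) + rise m (2 ^ j * s) * (displacement N η j (L j) m / N ^ j)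

lemma hasSum_pathTerm (hN : 2 ≤ N) (hη : 0 ≤ η) (hηN : η * N ≤ 1) {x : ℝ}
    (hx : HasSum (fun j => (((L j).1 m : ℕ) : ℝ) / N ^ (j + 1)) (Int.fract x)) (s : ℝ) :
    HasSum (pathTerm N η L m s) (path N η L m x s - ⌊x⌋) := by
  have hsub : path N η L m x s - ⌊x⌋
      = Int.fract x + ∑' j, rise m (2 ^ j * s) * (displacement N η j (L j) m / N ^ j) := by
    rw [path, ← Int.self_sub_floor]
    ring
  rw [hsub]
  exact hx.add (summable_path hN hη hηN m s).hasSum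

lemma exists_pow_mul_sum_pathTerm_eq (hN : 0 < N) {i : ℕ} {s : ℝ} (hs : 0 ≤ s)
    (hsi : (2 : ℝ) ^ i * s ≤ 1) :
    ∃ k : ℤ, N ^ i * ∑ j ∈ Finset.range i, pathTerm N η L m s j = k := by
  refine ⟨∑ j ∈ Finset.range i, ((L j).1 m : ℕ) * (N : ℤ) ^ (i - (j + 1)), ?_⟩
  push_cast
  rw [Finset.mul_sum]
  refine Finset.sum_congr rfl fun j hj => ?_
  have hji : j + 1 ≤ i := Finset.mem_range.1 hj
  have hrise : rise m (2 ^ j * s) = 0 := by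
    have hpow : (2 : ℝ) ^ (j + 1) * s ≤ 2 ^ i * s :=
      mul_le_mul_of_nonneg_right (pow_le_pow_right₀ one_le_two hji) hs
    rw [pow_succ] at hpow
    exact rise_of_le m (by linarith)
  have hpow : (N : ℝ) ^ i = N ^ (i - (j + 1)) * N ^ (j + 1) := by
    rw [← pow_add, Nat.sub_add_cancel hji]
  rw [pathTerm, hrise, zero_mul, add_zero, hpow]
  field_simp

lemma pow_mul_pathTerm_self (hN : 0 < N) (s : ℝ) (i : ℕ) :
    N ^ i * pathTerm N η L m s i
      = (((L i).1 m : ℕ) : ℝ) / N + rise m (2 ^ i * s) * displacement N η i (L i) m := by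
  rw [pathTerm, pow_succ]
  field_simp

lemma pow_mul_pathTerm_add (hN : 0 < N) {i : ℕ} {s : ℝ} (hs : 1 / 2 ≤ (2 : ℝ) ^ i * s) (r : ℕ) :
    N ^ i * pathTerm N η L m s (r + (i + 1))
      = gap N η i * (η ^ (r + 1) * (((L (r + (i + 1))).1 m : ℕ) : ℝ))
        + (((L (r + (i + 1))).2 : ℕ) : ℝ) / 2 * ((1 - 1 / N) / N * (1 / N) ^ r) := by
  have hrise : rise m (2 ^ (r + (i + 1)) * s) = 1 := by
    have hpow : (2 : ℝ) ^ (r + (i + 1)) * s = 2 ^ r * (2 * (2 ^ i * s)) := by ring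
    rw [hpow]
    exact rise_of_ge m (by nlinarith [one_le_pow₀ one_le_two (M₀ := ℝ) (n := r)])
  rw [pathTerm, hrise, displacement, gap, gap]
  simp only [div_pow, one_pow, mul_pow, pow_add]
  field_simp
  ring

lemma hasSum_family_mul_geometric (hN : 2 ≤ N) (b : ℝ) :
    HasSum (fun r : ℕ => b * ((1 - 1 / N) / N * (1 / (N : ℝ)) ^ r)) (b / N) := by
  have hN' : (1 : ℝ) < N := by exact_mod_cast hN
  have hne : (1 - 1 / N : ℝ) ≠ 0 := (sub_pos.2 ((div_lt_one (by linarith)).2 hN')).ne'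
  have hgeometric := hasSum_geometric_of_lt_one (r := 1 / (N : ℝ)) (by positivity)
    ((div_lt_one (by linarith)).2 hN')
  have hsum := (hgeometric.mul_left ((1 - 1 / N : ℝ) / N)).mul_left b
  rwa [div_mul_eq_mul_div, mul_inv_cancel₀ hne, mul_one_div] at hsum

-- While the `i`-th generation moves, the digits before the `i`-th one contribute a multiple of the
-- cell size, and those after it have been contracted by the finer generations.
lemma IsExpansion.exists_pow_mul_path_eq (hN : 2 ≤ N) (hη : 0 < η) (hηN : η * N ≤ 1 / 8) {b : Fin 2}
    {x : Fin (n + 2) → ℝ} (hL : IsExpansion b x L) (m : Fin (n + 2)) {i : ℕ} {s : ℝ}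
    (hs : (2 : ℝ) ^ i * s ∈ Icc (1 / 2 : ℝ) 1) :
    ∃ k : ℤ, ∃ τ ∈ Ico 0 (gap N η i / 4),
      N ^ i * path N η L m (x m) s = centre N η i (L i) m (rise m (2 ^ i * s)) + k + τ := by
  have hN₀ : 0 < N := by omega
  have hs₀ : 0 ≤ s := by
    have hpos : 0 < 2 ^ i * s := by linarith [hs.1]
    exact ((mul_pos_iff_of_pos_left (by positivity)).1 hpos).le
  obtain ⟨k, hk⟩ := exists_pow_mul_sum_pathTerm_eq (η := η) (L := L) (m := m) hN₀ hs₀ hs.2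
  obtain ⟨τ, hτ, hτsum⟩ := exists_hasSum_pow_mul_digits hη hηN fun r => (L (r + (i + 1))).1 m
  have hgap : 0 < gap N η i := gap_pos hN₀ hη
  have htail := (hτsum.mul_left (gap N η i)).add
    (hasSum_family_mul_geometric hN (((b : ℕ) : ℝ) / 2))
  have hpath := ((hasSum_nat_add_iff' (i + 1)).2
    (hasSum_pathTerm hN hη.le (by linarith) (hL.hasSum_digits m) s)).mul_left ((N : ℝ) ^ i)
  simp only [pow_mul_pathTerm_add hN₀ hs.1, hL.family] at hpath
  have heq := hpath.unique htail
  rw [Finset.sum_range_succ, mul_sub, mul_sub, mul_add, hk, pow_mul_pathTerm_self hN₀] at heq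
  refine ⟨k + N ^ i * ⌊x m⌋, gap N η i * τ, ⟨mul_nonneg hgap.le hτ.1, ?_⟩, ?_⟩
  · nlinarith [hτ.2]
  · rw [centre, hL.family]
    push_cast
    linear_combination heq

end Path

/-! ### The field along the explicit trajectories -/

section Along

variable {n N : ℕ} {η : ℝ} {i : ℕ} {s : ℝ}

/-- The point at time `s` of the explicit trajectory with the labels `L` that starts at time `0` in
the point `x`; the first coordinate is the time. -/
def pathPoint (N : ℕ) (η : ℝ) (L : ℕ → Label n N) (x : Fin (n + 2) → ℝ) (s : ℝ) : Torus (n + 3) :=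
  Fin.cons (s : UnitAddCircle) fun m => (path N η L m (x m) s : UnitAddCircle)

lemma generation_eq_zero_of_inactive (hs : s ∈ Icc (0 : ℝ) 1) {X : Torus (n + 3)}
    (hX : X 0 = (s : UnitAddCircle)) (hi : (2 : ℝ) ^ i * s ∉ Icc (1 / 2 : ℝ) (3 / 4))
    (j : Fin (n + 3)) : generation N η i j X = 0 := by
  have hclock : ∀ k : Fin (n + 2), clock (deriv (rise k)) i (X 0) = 0 := fun k => by
    rw [hX, clock_coe (isPulse_deriv_rise k) hs, deriv_rise_eq_zero k hi]
  simp [generation, ballField, movingBlock, block, hclock]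

lemma centreClock_coe (hs : s ∈ Icc (0 : ℝ) 1) (hi : (2 : ℝ) ^ i * s ≤ 3 / 4) (q : Label n N)
    (m : Fin (n + 2)) : centreClock N η i q m s = centre N η i q m (rise m (2 ^ i * s)) := by
  rw [centreClock, clock_coe (isPulse_risePulse m) hs, risePulse_of_le m hi]

variable {b : Fin 2} {x : Fin (n + 2) → ℝ} {L : ℕ → Label n N}

lemma IsExpansion.exists_offset_eq (hL : IsExpansion b x L) (hN : 2 ≤ N) (hη : 0 < η)
    (hηN : η * N ≤ 1 / 8) (hs : s ∈ Icc (0 : ℝ) 1) (hi : (2 : ℝ) ^ i * s ∈ Icc (1 / 2 : ℝ) (3 / 4))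
    (m : Fin (n + 2)) :
    ∃ τ ∈ Ico 0 (gap N η i / 4), ∀ q : Label n N,
      offset (centreClock N η i q) (N ^ i) m (pathPoint N η L x s)
        = ((τ + (centre N η i (L i) m (rise m (2 ^ i * s))
          - centre N η i q m (rise m (2 ^ i * s))) : ℝ) : UnitAddCircle) := by
  obtain ⟨k, τ, hτ, hpath⟩ :=
    hL.exists_pow_mul_path_eq hN hη hηN m ⟨hi.1, hi.2.trans (by norm_num)⟩
  refine ⟨τ, hτ, fun q => ?_⟩
  have hlift : (N ^ i : ℕ) • path N η L m (x m) s - centre N η i q m (rise m (2 ^ i * s))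
      = τ + (centre N η i (L i) m (rise m (2 ^ i * s))
          - centre N η i q m (rise m (2 ^ i * s))) + k := by
    rw [nsmul_eq_mul, Nat.cast_pow, hpath]
    ring
  have hcoe := congrArg (fun z : ℝ => (z : UnitAddCircle)) hlift
  rw [AddCircle.coe_add, coe_intCast_unitAddCircle, add_zero] at hcoe
  rw [← hcoe, offset, pathPoint, Fin.cons_zero, Fin.cons_succ, centreClock_coe hs hi.2]
  rfl

lemma IsExpansion.movingBlock_eq_zero (hL : IsExpansion b x L) (hN : 2 ≤ N) (hη : 0 < η)
    (hηN : η * N ≤ 1 / 8) (hs : s ∈ Icc (0 : ℝ) 1) (hi : (2 : ℝ) ^ i * s ∈ Icc (1 / 2 : ℝ) (3 / 4))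
    {q : Label n N} (hq : q ≠ L i) (k : Fin (n + 2)) {f : Fin (n + 2) → ℝ → ℝ}
    (hf : ∀ m, IsProfile (f m)) : movingBlock N η i q k f (pathPoint N η L x s) = 0 := by
  have hgap : 0 < gap N η i := gap_pos (by omega) hη
  have hstage : rise (0 : Fin (n + 2)) (2 ^ i * s) = 1 ∨ rise (1 : Fin (n + 2)) (2 ^ i * s) = 0 :=
    (le_total (5 / 8) (2 ^ i * s)).imp rise_zero_of_ge (rise_of_ne_zero_of_le one_ne_zero)
  obtain ⟨m, hm⟩ := exists_gap_le_norm_centre_sub (i := i) hη (by linarith) hq.symm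
    (θ := fun m => rise m (2 ^ i * s)) (fun m => rise_mem m _) hstage
  obtain ⟨τ, hτ, hoffset⟩ := hL.exists_offset_eq hN hη hηN hs hi m
  have hτnorm : ‖(τ : UnitAddCircle)‖ ≤ τ :=
    (UnitAddCircle.norm_eq ▸ round_le τ 0).trans_eq (by simp [abs_of_nonneg hτ.1])
  rw [movingBlock, block, Finset.prod_eq_zero (Finset.mem_univ m), mul_zero]
  refine latticeBump_eq_zero (hf m) (by positivity) ?_
  rw [hoffset, AddCircle.coe_add]
  have htriangle := norm_sub_le
    ((τ : UnitAddCircle) + ((centre N η i (L i) m (rise m (2 ^ i * s))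
      - centre N η i q m (rise m (2 ^ i * s)) : ℝ) : UnitAddCircle)) τ
  rw [add_sub_cancel_left] at htriangle
  linarith [hτ.2]

lemma IsExpansion.exists_movingBlock_eq (hL : IsExpansion b x L) (hN : 2 ≤ N) (hη : 0 < η)
    (hηN : η * N ≤ 1 / 8) (hs : s ∈ Icc (0 : ℝ) 1)
    (hi : (2 : ℝ) ^ i * s ∈ Icc (1 / 2 : ℝ) (3 / 4)) :
    ∃ z : Fin (n + 2) → ℝ, (∀ m, |z m| < 1) ∧ ∀ k f,
      movingBlock N η i (L i) k f (pathPoint N η L x s)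
        = deriv (rise k) (2 ^ i * s) * ∏ m, f m (z m) := by
  have hN' : (2 : ℝ) ≤ N := by exact_mod_cast hN
  have hgap : 0 < gap N η i / 4 := div_pos (gap_pos (by omega) hη) four_pos
  have hgap' : gap N η i ≤ 1 / 8 := (gap_le hη.le (by linarith)).trans (by nlinarith)
  choose τ hτ hoffset using hL.exists_offset_eq hN hη hηN hs hi
  refine ⟨fun m => τ m / (gap N η i / 4), fun m => ?_, fun k f => ?_⟩
  · rw [abs_of_nonneg (div_nonneg (hτ m).1 hgap.le), div_lt_one hgap]
    exact (hτ m).2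
  · rw [movingBlock, block]
    congr 1
    · rw [pathPoint, Fin.cons_zero, clock_coe (isPulse_deriv_rise k) hs]
    · refine Finset.prod_congr rfl fun m _ => ?_
      rw [hoffset, sub_self, add_zero, latticeBump_coe_of_mem_Ico]
      constructor <;> linarith [(hτ m).1, (hτ m).2]

lemma IsExpansion.ballField_eq (hL : IsExpansion b x L) (hN : 2 ≤ N) (hη : 0 < η)
    (hηN : η * N ≤ 1 / 8) (hs : s ∈ Icc (0 : ℝ) 1) (hi : (2 : ℝ) ^ i * s ∈ Icc (1 / 2 : ℝ) (3 / 4))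
    (q : Label n N) (k : Fin (n + 2)) (j : Fin (n + 3)) :
    ballField N η i q k j (pathPoint N η L x s)
      = if q = L i ∧ j = k.succ then displacement N η i q k * deriv (rise k) (2 ^ i * s)
        else 0 := by
  by_cases hq : q = L i
  · obtain ⟨z, hz, hblock⟩ := hL.exists_movingBlock_eq hN hη hηN hs hi
    have hmain : ∏ m, mainProfile k m (z m) = 1 :=
      Finset.prod_eq_one fun m _ => mainProfile_eq_one k m (hz m)
    have hside : ∏ m, sideProfile k m (z m) = 0 :=
      Finset.prod_eq_zero (Finset.mem_univ k) (sideProfile_self_eq_zero k (hz k))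
    simp [ballField, hq, hblock, hmain, hside]
  · simp [ballField, hq, hL.movingBlock_eq_zero hN hη hηN hs hi hq k (isProfile_mainProfile k),
      hL.movingBlock_eq_zero hN hη hηN hs hi hq k (isProfile_sideProfile k)]

lemma IsExpansion.generation_pathPoint (hL : IsExpansion b x L) (hN : 2 ≤ N) (hη : 0 < η)
    (hηN : η * N ≤ 1 / 8) (hs : s ∈ Icc (0 : ℝ) 1) (i : ℕ) (k : Fin (n + 2)) :
    generation N η i k.succ (pathPoint N η L x s)
      = (2 / N) ^ i * (deriv (rise k) (2 ^ i * s) * displacement N η i (L i) k) := by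
  by_cases hi : (2 : ℝ) ^ i * s ∈ Icc (1 / 2 : ℝ) (3 / 4)
  · rw [generation, mul_comm (deriv (rise k) _), Finset.sum_eq_single (L i), Finset.sum_eq_single k]
    · simp [hL.ballField_eq hN hη hηN hs hi]
    · intro k' _ hk'
      simp [hL.ballField_eq hN hη hηN hs hi, hk'.symm]
    · simp
    · intro q _ hq
      simp [hL.ballField_eq hN hη hηN hs hi, hq]
    · simp
  · rw [generation_eq_zero_of_inactive hs (by simp [pathPoint]) hi, deriv_rise_eq_zero k hi,
      zero_mul, mul_zero]

end Along

/-! ### Solutions in the universal cover -/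

section Solutions

lemma hasDerivWithinAt_Icc_of_Icc_of_Icc {E : Type*} [NormedAddCommGroup E] [NormedSpace ℝ E]
    {f f' : ℝ → E} {a b c : ℝ}
    (hab : ∀ t ∈ Icc a b, HasDerivWithinAt f (f' t) (Icc a b) t)
    (hbc : ∀ t ∈ Icc b c, HasDerivWithinAt f (f' t) (Icc b c) t) :
    ∀ t ∈ Icc a c, HasDerivWithinAt f (f' t) (Icc a c) t := by
  intro t ht
  rcases lt_trichotomy t b with htb | rfl | hbt
  · refine (hab t ⟨ht.1, htb.le⟩).mono_of_mem_nhdsWithin ?_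
    filter_upwards [self_mem_nhdsWithin, mem_nhdsWithin_of_mem_nhds (Iic_mem_nhds htb)]
      with r hr hrb using ⟨hr.1, hrb⟩
  · rw [← Icc_union_Icc_eq_Icc ht.1 ht.2]
    exact (hab t ⟨ht.1, le_rfl⟩).union (hbc t ⟨le_rfl, ht.2⟩)
  · refine (hbc t ⟨hbt.le, ht.2⟩).mono_of_mem_nhdsWithin ?_
    filter_upwards [self_mem_nhdsWithin, mem_nhdsWithin_of_mem_nhds (Ici_mem_nhds hbt)]
      with r hr hbr using ⟨hbr, hr.2⟩

variable {d : ℕ}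

lemma hasDerivWithinAt_euclideanSpace {Γ : ℝ → Space d} {v : Space d} {S : Set ℝ} {t : ℝ} :
    HasDerivWithinAt Γ v S t ↔ ∀ j, HasDerivWithinAt (fun s => Γ s j) (v j) S t := by
  refine ⟨fun h j => ?_, fun h => ?_⟩
  · exact (EuclideanSpace.proj j : Space d →L[ℝ] ℝ).hasFDerivAt.comp_hasDerivWithinAt t h
  · exact ((EuclideanSpace.equiv (Fin d) ℝ).symm : (Fin d → ℝ) →L[ℝ] Space d).hasFDerivAt
      |>.comp_hasDerivWithinAt t (hasDerivWithinAt_pi.2 h)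

/-- The curve `Γ` in the universal cover `ℝ^d` of the torus solves `Γ' = u(Γ)` on `[0, T]`, with
one-sided derivatives at the end points. -/
def SolvesOn (u : Torus d → Space d) (T : ℝ) (Γ : ℝ → Space d) : Prop :=
  ∀ t ∈ Icc 0 T, HasDerivWithinAt Γ (u (toTorus (Γ t))) (Icc 0 T) t

namespace SolvesOn

variable {u : Torus d → Space d} {T T₁ T₂ : ℝ} {Γ Γ₁ Γ₂ : ℝ → Space d}

lemma mono (h : SolvesOn u T₂ Γ) (hT : T₁ ≤ T₂) : SolvesOn u T₁ Γ := fun t ht =>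
  (h t ⟨ht.1, ht.2.trans hT⟩).mono (Icc_subset_Icc_right hT)

lemma isTrajectory (h : SolvesOn u T Γ) (hT : 0 ≤ T) (hu : Continuous u) :
    IsTrajectory u T (toTorus (Γ 0)) (fun t => toTorus (Γ t)) := by
  refine ⟨?_, fun t ht => ⟨Γ, fun _ _ => rfl, h t ht⟩, rfl⟩
  obtain ⟨K, hK⟩ := (isCompact_range hu).isBounded.exists_norm_le
  have hlipschitz : LipschitzOnWith K.toNNReal Γ (Icc 0 T) :=
    (convex_Icc 0 T).lipschitzOnWith_of_nnnorm_hasDerivWithin_le h fun t _ =>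
      NNReal.coe_le_coe.1 ((hK _ ⟨_, rfl⟩).trans (Real.le_coe_toNNReal K))
  refine LipschitzOnWith.absolutelyContinuousOnInterval (K := 1 * K.toNNReal) ?_
  rw [uIcc_of_le hT]
  exact lipschitzWith_toTorus.comp_lipschitzOnWith hlipschitz

lemma exists_glue (h₁ : SolvesOn u T₁ Γ₁) (h₂ : SolvesOn u T₂ Γ₂) (h : Γ₂ 0 = Γ₁ T₁) :
    ∃ Γ, SolvesOn u (T₁ + T₂) Γ ∧ (∀ t ∈ Icc 0 T₁, Γ t = Γ₁ t) ∧
      ∀ t ∈ Icc 0 T₂, Γ (T₁ + t) = Γ₂ t := by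
  set Γ : ℝ → Space d := fun t => if t ≤ T₁ then Γ₁ t else Γ₂ (t - T₁) with hΓ
  have hΓ₁ : ∀ t ∈ Icc 0 T₁, Γ t = Γ₁ t := fun t ht => if_pos ht.2
  have hΓ₂ : ∀ t ∈ Icc T₁ (T₁ + T₂), Γ t = Γ₂ (t - T₁) := by
    intro t ht
    rcases ht.1.eq_or_lt with rfl | hlt
    · simp [hΓ, h]
    · simp [hΓ, hlt.not_ge]
  refine ⟨Γ, hasDerivWithinAt_Icc_of_Icc_of_Icc (b := T₁) (fun t ht => ?_) (fun t ht => ?_), hΓ₁,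
    fun t ht => ?_⟩
  · rw [hΓ₁ t ht]
    exact (h₁ t ht).congr hΓ₁ (hΓ₁ t ht)
  · rw [hΓ₂ t ht]
    refine HasDerivWithinAt.congr ?_ hΓ₂ (hΓ₂ t ht)
    have hshift : MapsTo (fun r => r - T₁) (Icc T₁ (T₁ + T₂)) (Icc 0 T₂) :=
      fun r hr => ⟨sub_nonneg.2 hr.1, by linarith [hr.2]⟩
    simpa only [one_smul, Function.comp_def, id] using
      HasDerivWithinAt.scomp t (h₂ (t - T₁) (hshift ht))
        ((hasDerivAt_id t).sub_const T₁).hasDerivWithinAt hshift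
  · rw [hΓ₂ (T₁ + t) ⟨by linarith [ht.1], by linarith [ht.2]⟩, add_sub_cancel_left]

lemma apply_eq_add_mul (h : SolvesOn u T Γ) {j : Fin d} {v : ℝ} (hu : ∀ x, u x j = v) {t : ℝ}
    (ht : t ∈ Icc 0 T) : Γ t j = Γ 0 j + v * t := by
  have hderiv : ∀ r ∈ Icc 0 T, HasDerivWithinAt (fun r => Γ r j - v * r) 0 (Icc 0 T) r := by
    intro r hr
    have hj := hasDerivWithinAt_euclideanSpace.1 (h r hr) j
    simpa [hu] using hj.fun_sub ((hasDerivWithinAt_id r _).const_mul v)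
  have hconst := (convex_Icc 0 T).norm_image_sub_le_of_norm_hasDerivWithin_le (C := 0) hderiv
    (fun r _ => by simp) ⟨le_rfl, ht.1.trans ht.2⟩ ht
  rw [zero_mul, norm_le_zero_iff] at hconst
  linarith

end SolvesOn

lemma exists_solvesOn_of_lipschitzWith {u : Torus d → Space d} {K : ℝ≥0} (hu : LipschitzWith K u)
    {T : ℝ} (hT : 0 ≤ T) (X₀ : Space d) : ∃ Γ, Γ 0 = X₀ ∧ SolvesOn u T Γ := by
  obtain ⟨B, hB⟩ := (isCompact_range hu.continuous).isBounded.exists_norm_le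
  have hpicard : IsPicardLindelof (fun (_ : ℝ) (X : Space d) => u (toTorus X))
      (⟨0, le_rfl, hT⟩ : Icc (0 : ℝ) T) X₀ (B.toNNReal * T.toNNReal) 0 B.toNNReal (K * 1) :=
    { lipschitzOnWith := fun _ _ => (hu.comp lipschitzWith_toTorus).lipschitzOnWith
      continuousOn := fun _ _ => continuousOn_const
      norm_le := fun _ _ X _ => (hB _ ⟨_, rfl⟩).trans (Real.le_coe_toNNReal B)
      mul_max_le := by simp [hT] }
  exact hpicard.exists_eq_forall_mem_Icc_hasDerivWithinAt₀

end Solutions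

/-! ### The steady field and its solutions -/

section SteadyField

variable {n N : ℕ} {η lam : ℝ}

/-- The steady field: the coordinate `x 0` plays the role of time and grows with speed `lam`, and
the balls of all generations move in the other coordinates. -/
def steadyField (n N : ℕ) (η lam : ℝ) (x : Torus (n + 3)) : Space (n + 3) :=
  WithLp.toLp 2 fun j => lam * ((if j = 0 then 1 else 0) + ∑' i, generation N η i j x)

/-- The part of the steady field that consists of the drift and the generations before `M`; unlike
the whole field, it is Lipschitz. -/
def truncatedField (n N : ℕ) (η lam : ℝ) (M : ℕ) (x : Torus (n + 3)) : Space (n + 3) :=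
  WithLp.toLp 2 fun j =>
    lam * ((if j = 0 then 1 else 0) + ∑ i ∈ Finset.range M, generation N η i j x)

lemma continuous_steadyField (hN : 3 ≤ N) (hη : 0 < η) (hηN : η * N ≤ 1) :
    Continuous (steadyField n N η lam) := by
  obtain ⟨C, hC⟩ := exists_isGeometric_generation n hN hη hηN
  refine (PiLp.continuous_toLp 2 _).comp (continuous_pi fun j => ?_)
  exact ((hC j).continuous_tsum.const_add _).const_mul _

lemma exists_lipschitzWith_truncatedField (lam : ℝ) (hN : 3 ≤ N) (hη : 0 < η) (hηN : η * N ≤ 1)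
    (M : ℕ) : ∃ K, LipschitzWith K (truncatedField n N η lam M) := by
  obtain ⟨C, hC⟩ := exists_isGeometric_generation n hN hη hηN
  have hsum : ∀ j, MemHolder 1 fun x : Torus (n + 3) =>
      ∑ i ∈ Finset.range M, generation N η i j x := fun j =>
    (IsLocalized.sum (S := univ) fun i _ =>
      ((hC j).isLocalized i).mono le_rfl le_rfl (subset_univ _)).memHolder_one
  obtain ⟨K, hK⟩ := memHolder_of_forall_apply (u := truncatedField n N η lam M) fun j =>
    ((memHolder_const' (c := if j = 0 then 1 else 0)).add (hsum j)).smul (c := lam)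
  exact ⟨K, holderWith_one.1 hK⟩

lemma steadyField_eq_truncatedField {x : Torus (n + 3)} {s : ℝ} (hs : s ∈ Icc (0 : ℝ) 1)
    (hx : x 0 = (s : UnitAddCircle)) {M : ℕ} (hM : 1 ≤ 2 ^ M * s) :
    steadyField n N η lam x = truncatedField n N η lam M x := by
  have hinactive : ∀ j, ∀ i ∉ Finset.range M, generation N η i j x = 0 := by
    intro j i hi
    refine generation_eq_zero_of_inactive hs hx (fun hmem => ?_) j
    have hpow : (2 : ℝ) ^ M * s ≤ 2 ^ i * s :=
      mul_le_mul_of_nonneg_right (pow_le_pow_right₀ one_le_two (by simpa using hi)) hs.1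
    linarith [hmem.2]
  simp only [steadyField, truncatedField, tsum_eq_sum (hinactive _)]

/-- The lift, with time scaled by `lam`, of the explicit trajectory with the labels `L`. -/
def liftedPath (N : ℕ) (η lam : ℝ) (L : ℕ → Label n N) (X₀ : Space (n + 3)) (t : ℝ) :
    Space (n + 3) :=
  WithLp.toLp 2 (Fin.cons (X₀ 0 + lam * t) fun m => path N η L m (X₀ m.succ) (lam * t))

variable {b : Fin 2} {L : ℕ → Label n N} {X₀ : Space (n + 3)} {k : ℤ}

lemma liftedPath_apply_zero (t : ℝ) : liftedPath N η lam L X₀ t 0 = X₀ 0 + lam * t := rfl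

lemma liftedPath_apply_succ (t : ℝ) (m : Fin (n + 2)) :
    liftedPath N η lam L X₀ t m.succ = path N η L m (X₀ m.succ) (lam * t) := rfl

lemma liftedPath_zero : liftedPath N η lam L X₀ 0 = X₀ := by
  ext j
  cases j using Fin.cases <;> simp [liftedPath_apply_zero, liftedPath_apply_succ, path_zero]

lemma toTorus_liftedPath (hX₀ : X₀ 0 = k) (t : ℝ) :
    toTorus (liftedPath N η lam L X₀ t) = pathPoint N η L (fun m => X₀ m.succ) (lam * t) := by
  ext j
  cases j using Fin.cases with
  | zero => simp [toTorus, liftedPath_apply_zero, pathPoint, hX₀, coe_intCast_unitAddCircle]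
  | succ m => simp [toTorus, liftedPath_apply_succ, pathPoint]

lemma IsExpansion.solvesOn_liftedPath (hL : IsExpansion b (fun m => X₀ m.succ) L) (hN : 3 ≤ N)
    (hη : 0 < η) (hηN : η * N ≤ 1 / 8) (hlam : 0 < lam) (hX₀ : X₀ 0 = k) :
    SolvesOn (steadyField n N η lam) (1 / lam) (liftedPath N η lam L X₀) := by
  intro t ht
  have hs : lam * t ∈ Icc (0 : ℝ) 1 :=
    ⟨mul_nonneg hlam.le ht.1, (le_div_iff₀' hlam).1 ht.2⟩
  have hscale : HasDerivAt (fun t : ℝ => lam * t) lam t := hasDerivAt_const_mul lam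
  refine hasDerivWithinAt_euclideanSpace.2 fun j => HasDerivAt.hasDerivWithinAt ?_
  rw [toTorus_liftedPath hX₀]
  cases j using Fin.cases with
  | zero =>
    simpa [steadyField, liftedPath_apply_zero, generation_zero] using hscale.const_add (X₀ 0)
  | succ m =>
    refine ((hasDerivAt_path (L := L) hN hη.le (by linarith) m (X₀ m.succ) (lam * t)).comp t
      hscale).congr_deriv ?_
    simp [steadyField, hL.generation_pathPoint (by omega) hη hηN hs, mul_comm _ lam]

lemma path_sub_path (hN : 2 ≤ N) (hη : 0 ≤ η) (hηN : η * N ≤ 1) (D : ℕ → Fin (n + 2) → Fin N)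
    (m : Fin (n + 2)) (x : ℝ) :
    path N η (fun j => (D j, 1)) m x 1 - path N η (fun j => (D j, 0)) m x 1 = 1 / 2 := by
  have hterm : ∀ j : ℕ, rise m (2 ^ j * 1) * (displacement N η j (D j, 1) m / N ^ j)
      - rise m (2 ^ j * 1) * (displacement N η j (D j, 0) m / N ^ j)
        = N / 2 * ((1 - 1 / N) / N * (1 / N) ^ j) := by
    intro j
    have hpow : (1 : ℝ) ≤ 2 ^ j := one_le_pow₀ one_le_two
    have hN₀ : (N : ℝ) ≠ 0 := by positivity
    rw [rise_of_ge m (by linarith), displacement, displacement, div_pow, one_pow]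
    simp only [Fin.val_one, Fin.val_zero, Nat.cast_one, Nat.cast_zero]
    field_simp
    ring
  rw [path, path, add_sub_add_left_eq_sub,
    ← (summable_path hN hη hηN m 1).tsum_sub (summable_path hN hη hηN m 1), tsum_congr hterm,
    (hasSum_family_mul_geometric hN _).tsum_eq]
  field_simp

lemma exists_solvesOn_pair_of_intCast (hN : 3 ≤ N) (hη : 0 < η) (hηN : η * N ≤ 1 / 8)
    (hlam : 0 < lam) (hX₀ : X₀ 0 = k) :
    ∃ Γ : Fin 2 → ℝ → Space (n + 3), (∀ b, Γ b 0 = X₀) ∧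
      (∀ b, SolvesOn (steadyField n N η lam) (1 / lam) (Γ b)) ∧
      (∀ b, Γ b (1 / lam) 0 = ((k + 1 : ℤ) : ℝ)) ∧
      Γ 1 (1 / lam) 1 - Γ 0 (1 / lam) 1 = 1 / 2 := by
  obtain ⟨D, hD⟩ := exists_isExpansion (N := N) (by omega) fun m : Fin (n + 2) => X₀ m.succ
  have hperiod : lam * (1 / lam) = 1 := mul_one_div_cancel hlam.ne'
  refine ⟨fun b => liftedPath N η lam (fun j => (D j, b)) X₀, fun b => liftedPath_zero,
    fun b => (hD b).solvesOn_liftedPath hN hη hηN hlam hX₀, fun b => ?_, ?_⟩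
  · rw [liftedPath_apply_zero, hX₀, hperiod, Int.cast_add, Int.cast_one]
  · rw [← Fin.succ_zero_eq_one, liftedPath_apply_succ, liftedPath_apply_succ, hperiod]
    exact path_sub_path (by omega) hη.le (by linarith) D 0 _

lemma exists_solvesOn_natCast_mul (hN : 3 ≤ N) (hη : 0 < η) (hηN : η * N ≤ 1 / 8) (hlam : 0 < lam)
    (P : ℕ) (hX₀ : X₀ 0 = k) :
    ∃ Γ, Γ 0 = X₀ ∧ SolvesOn (steadyField n N η lam) (P * (1 / lam)) Γ := by
  induction P generalizing X₀ k with
  | zero =>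
    refine ⟨fun _ => X₀, rfl, ?_⟩
    rw [Nat.cast_zero, zero_mul, SolvesOn, Icc_self]
    exact fun t _ => HasFDerivWithinAt.of_subsingleton subsingleton_singleton
  | succ P ih =>
    obtain ⟨Γ₁, hstart₁, hΓ₁, hend, -⟩ := exists_solvesOn_pair_of_intCast hN hη hηN hlam hX₀
    obtain ⟨Γ₂, hstart₂, hΓ₂⟩ := ih (hend 0)
    obtain ⟨Γ, hΓ, heq, -⟩ := (hΓ₁ 0).exists_glue hΓ₂ hstart₂
    refine ⟨Γ, by rw [heq 0 ⟨le_rfl, by positivity⟩, hstart₁], ?_⟩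
    rwa [Nat.cast_succ, add_one_mul, add_comm (_ * _)]

lemma exists_solvesOn_to_intCast (hN : 3 ≤ N) (hη : 0 < η) (hηN : η * N ≤ 1) (hlam : 0 < lam)
    (X₀ : Space (n + 3)) :
    ∃ T ∈ Icc 0 (1 / lam), ∃ Γ, Γ 0 = X₀ ∧ SolvesOn (steadyField n N η lam) T Γ ∧
      ∃ k : ℤ, Γ T 0 = k := by
  set s₀ : ℝ := X₀ 0 - (⌈X₀ 0⌉ - 1) with hs₀
  have hs₀_pos : 0 < s₀ := by linarith [Int.ceil_lt_add_one (X₀ 0)]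
  have hs₀_le : s₀ ≤ 1 := by linarith [Int.le_ceil (X₀ 0)]
  set T : ℝ := (1 - s₀) / lam with hT
  have hT₀ : 0 ≤ T := div_nonneg (by linarith) hlam.le
  have hTlam : lam * T = 1 - s₀ := mul_div_cancel₀ _ hlam.ne'
  obtain ⟨M, hM⟩ := pow_unbounded_of_one_lt (1 / s₀) one_lt_two
  obtain ⟨K, hK⟩ := exists_lipschitzWith_truncatedField (n := n) lam hN hη hηN M
  obtain ⟨Γ, hstart, hΓ⟩ := exists_solvesOn_of_lipschitzWith hK hT₀ X₀
  have htime : ∀ t ∈ Icc 0 T, Γ t 0 = X₀ 0 + lam * t := fun t ht => by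
    rw [hΓ.apply_eq_add_mul (j := 0) (v := lam) (by simp [truncatedField, generation_zero]) ht,
      hstart]
  refine ⟨T, ⟨hT₀, by rw [hT]; gcongr; linarith⟩, Γ, hstart, fun t ht => ?_, ⌈X₀ 0⌉, ?_⟩
  · have ht₀ : 0 ≤ lam * t := mul_nonneg hlam.le ht.1
    have ht₁ : lam * t ≤ 1 - s₀ := hTlam ▸ mul_le_mul_of_nonneg_left ht.2 hlam.le
    rw [steadyField_eq_truncatedField (M := M) (s := s₀ + lam * t) ⟨by linarith, by linarith⟩]
    · exact hΓ t ht
    · have hlift : Γ t 0 = s₀ + lam * t + ((⌈X₀ 0⌉ - 1 : ℤ) : ℝ) := by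
        rw [htime t ht, hs₀]
        push_cast
        ring
      rw [toTorus, hlift, AddCircle.coe_add _ _ ((⌈X₀ 0⌉ - 1 : ℤ) : ℝ), coe_intCast_unitAddCircle,
        add_zero]
    · calc (1 : ℝ) ≤ 2 ^ M * s₀ := ((div_lt_iff₀ hs₀_pos).1 hM).le
        _ ≤ 2 ^ M * (s₀ + lam * t) := by gcongr; linarith
  · rw [htime T ⟨hT₀, le_rfl⟩, hTlam, hs₀]
    ring

lemma exists_solvesOn_pair (hN : 3 ≤ N) (hη : 0 < η) (hηN : η * N ≤ 1 / 8) (hlam : 0 < lam) {T : ℝ}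
    (hT : 2 / lam ≤ T) (X₀ : Space (n + 3)) :
    ∃ Γ : Fin 2 → ℝ → Space (n + 3), (∀ b, Γ b 0 = X₀) ∧
      (∀ b, SolvesOn (steadyField n N η lam) T (Γ b)) ∧
      ∃ t ∈ Icc 0 T, Γ 1 t 1 - Γ 0 t 1 = 1 / 2 := by
  have hlam' : 0 < 1 / lam := by positivity
  obtain ⟨T₁, hT₁, Γ₁, hstart₁, hΓ₁, k, hk⟩ :=
    exists_solvesOn_to_intCast hN hη (by linarith) hlam X₀
  obtain ⟨Γ₂, hstart₂, hΓ₂, hend₂, hdiff⟩ := exists_solvesOn_pair_of_intCast hN hη hηN hlam hk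
  obtain ⟨P, hP⟩ := exists_nat_ge (T * lam)
  have hlong : T ≤ T₁ + 1 / lam + P * (1 / lam) := by
    have hperiods : T ≤ P * (1 / lam) := by rwa [mul_one_div, le_div_iff₀ hlam]
    linarith [hT₁.1]
  have hfull : ∀ b : Fin 2, ∃ Γ, Γ 0 = X₀ ∧ SolvesOn (steadyField n N η lam) T Γ ∧
      Γ (T₁ + 1 / lam) = Γ₂ b (1 / lam) := by
    intro b
    obtain ⟨Γ₃, hstart₃, hΓ₃⟩ := exists_solvesOn_natCast_mul hN hη hηN hlam P (hend₂ b)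
    obtain ⟨Γ₁₂, hΓ₁₂, heq₁, heq₂⟩ := hΓ₁.exists_glue (hΓ₂ b) (hstart₂ b)
    have hend := heq₂ (1 / lam) ⟨hlam'.le, le_rfl⟩
    obtain ⟨Γ, hΓ, heq, -⟩ := hΓ₁₂.exists_glue hΓ₃ (hstart₃.trans hend.symm)
    refine ⟨Γ, ?_, hΓ.mono hlong, ?_⟩
    · rw [heq 0 ⟨le_rfl, by linarith [hT₁.1]⟩, heq₁ 0 ⟨le_rfl, hT₁.1⟩, hstart₁]
    · rw [heq _ ⟨by linarith [hT₁.1], le_rfl⟩, hend]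
  choose Γ hstart hΓ hend using hfull
  refine ⟨Γ, hstart, hΓ, T₁ + 1 / lam, ⟨by linarith [hT₁.1], ?_⟩, by rw [hend, hend, hdiff]⟩
  calc T₁ + 1 / lam ≤ 1 / lam + 1 / lam := by linarith [hT₁.2]
    _ = 2 / lam := by ring
    _ ≤ T := hT

lemma nonuniquenessSet_steadyField (hN : 3 ≤ N) (hη : 0 < η) (hηN : η * N ≤ 1 / 8) (hlam : 0 < lam)
    {T : ℝ} (hT : 2 / lam ≤ T) : nonuniquenessSet (steadyField n N η lam) T = univ := by
  refine eq_univ_of_forall fun x => ?_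
  obtain ⟨X₀, rfl⟩ := isOpenQuotientMap_toTorus.surjective x
  obtain ⟨Γ, hstart, hΓ, t, ht, hdiff⟩ := exists_solvesOn_pair hN hη hηN hlam hT X₀
  have htrajectory : ∀ b, IsTrajectory (steadyField n N η lam) T (toTorus X₀)
      fun t => toTorus (Γ b t) := fun b =>
    hstart b ▸ (hΓ b).isTrajectory (ht.1.trans ht.2) (continuous_steadyField hN hη (by linarith))
  refine ⟨_, _, htrajectory 1, htrajectory 0, t, ht, fun heq => ?_⟩
  have hhalf : ((1 / 2 : ℝ) : UnitAddCircle) = 0 := by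
    rw [← hdiff, AddCircle.coe_sub]
    exact sub_eq_zero.2 (congrFun heq 1)
  rw [AddCircle.coe_eq_zero_iff_of_mem_Ico ⟨by norm_num, by norm_num⟩] at hhalf
  norm_num at hhalf

end SteadyField

/-! ### Regularity of the steady field -/

section Regularity

variable {n N : ℕ} {η p : ℝ}

lemma hasWeakPartialDeriv_steadyField (hN : 3 ≤ N) (hη : 0 < η) (hηN : η * N ≤ 1) (hp : 1 ≤ p)
    (hlr : (2 / (N * η)) ^ p * (η * N) ^ (n + 2) < 1) (lam : ℝ) (i j : Fin (n + 3)) :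
    HasWeakPartialDeriv j (fun x => steadyField n N η lam x i)
      (fun x => lam * ∑' k, generationDeriv N η k i j x) := by
  obtain ⟨C, hC⟩ := exists_isGeometric_generation n hN hη hηN
  exact (((hC i).hasWeakPartialDeriv_tsum j ((hC i).slope_mul_lt_one hp hlr)).const_add _).const_mul
    lam

lemma memSobolev_steadyField (hN : 3 ≤ N) (hη : 0 < η) (hηN : η * N ≤ 1) (hp : 1 ≤ p)
    (hlr : (2 / (N * η)) ^ p * (η * N) ^ (n + 2) < 1) (lam : ℝ) :
    MemSobolev (ENNReal.ofReal p) (steadyField n N η lam) := by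
  obtain ⟨C, hC⟩ := exists_isGeometric_generation n hN hη hηN
  refine ⟨(continuous_steadyField hN hη hηN).memLp_of_hasCompactSupport
    (HasCompactSupport.of_compactSpace _), fun i j => ⟨_, ?_,
      hasWeakPartialDeriv_steadyField hN hη hηN hp hlr lam i j⟩⟩
  exact ((hC i).memLp_tsum_deriv j (by linarith) hlr).const_mul lam

lemma memHolder_steadyField (hN : 3 ≤ N) (hη : 0 < η) (hηN : η * N ≤ 1) {α : ℝ≥0} (hα : α ≤ 1)
    (hal : (2 / (N : ℝ)) ^ (1 - α : ℝ) * (2 / (N * η)) ^ (α : ℝ) < 1) (lam : ℝ) :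
    MemHolder α (steadyField n N η lam) := by
  obtain ⟨C, hC⟩ := exists_isGeometric_generation n hN hη hηN
  exact memHolder_of_forall_apply fun j =>
    ((memHolder_const' (c := if j = 0 then 1 else 0)).add ((hC j).memHolder_tsum hα hal)).smul
      (c := lam)

lemma isDivergenceFree_steadyField (hN : 3 ≤ N) (hη : 0 < η) (hηN : η * N ≤ 1) (hp : 1 ≤ p)
    (hlr : (2 / (N * η)) ^ p * (η * N) ^ (n + 2) < 1) (lam : ℝ) :
    IsDivergenceFree (steadyField n N η lam) := by
  obtain ⟨C, hC⟩ := exists_isGeometric_generation n hN hη hηN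
  refine isDivergenceFree_of_hasWeakPartialDeriv
    (fun j => hasWeakPartialDeriv_steadyField hN hη hηN hp hlr lam j j) fun x => ?_
  rw [← Finset.mul_sum, ← Summable.tsum_finsetSum fun j _ => (hC j).summable_deriv j x]
  simp [sum_generationDeriv]

-- With `ε = η * N` fixed small, the second condition is `2 ^ p * ε ^ (n + 2 - p) < 1`; the first
-- one then holds for large `N`.
lemma exists_parameters (n : ℕ) {p α : ℝ} (hp : p < n + 2) (hα : α < 1) :
    ∃ (N : ℕ) (η : ℝ), 3 ≤ N ∧ 0 < η ∧ η * N ≤ 1 / 8 ∧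
      (2 / (N : ℝ)) ^ (1 - α) * (2 / (N * η)) ^ α < 1 ∧
      (2 / (N * η)) ^ p * (η * N) ^ (n + 2) < 1 := by
  have hε_tendsto : Filter.Tendsto (fun ε : ℝ => 2 ^ p * ε ^ (n + 2 - p)) (nhds 0) (nhds 0) :=
    ((Real.continuous_rpow_const (by linarith)).const_mul _).tendsto' _ _
      (by rw [Real.zero_rpow (by linarith), mul_zero])
  have hε_small := (hε_tendsto.eventually_lt_const one_pos).filter_mono
    (nhdsWithin_le_nhds (s := Ioi 0))
  obtain ⟨ε, hεp, hε, hε₈⟩ := (hε_small.and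
    (Ioc_mem_nhdsGT (by norm_num : (0 : ℝ) < 1 / 8))).exists
  have hN_tendsto : Filter.Tendsto (fun N : ℕ => (2 / (N : ℝ)) ^ (1 - α) * (2 / ε) ^ α)
      Filter.atTop (nhds 0) := by
    have hpow := (tendsto_const_div_atTop_nhds_zero_nat (2 : ℝ)).rpow_const (p := 1 - α)
      (Or.inr (by linarith))
    simpa [Real.zero_rpow (by linarith : 1 - α ≠ 0)] using hpow.mul_const ((2 / ε) ^ α)
  obtain ⟨N, hNα, hN⟩ := ((hN_tendsto.eventually_lt_const one_pos).and
    (Filter.eventually_ge_atTop 3)).exists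
  have hN₀ : (0 : ℝ) < N := by exact_mod_cast (by omega : 0 < N)
  have hεN : ε / N * N = ε := div_mul_cancel₀ ε hN₀.ne'
  refine ⟨N, ε / N, hN, by positivity, by rwa [hεN], ?_, ?_⟩
  · rwa [mul_comm (N : ℝ), hεN]
  · rw [mul_comm (N : ℝ), hεN, Real.div_rpow two_pos.le hε.le, div_mul_eq_mul_div, mul_div_assoc]
    rwa [Real.rpow_sub hε, ← Nat.cast_ofNat (R := ℝ), ← Nat.cast_add, Real.rpow_natCast] at hεp

end Regularity

end SteadyFlow

end

open SteadyFlow in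
theorem theorem2_general {d : ℕ} {p : ℝ} (hp : 1 ≤ p) (hpd : p < (d : ℝ) - 1) {α : ℝ≥0}
    (hα₁ : α < 1) {T₀ : ℝ} (hT₀ : 0 < T₀) :
    ∃ u : Torus d → Space d, MemSobolev (ENNReal.ofReal p) u ∧ MemHolder α u ∧
      IsDivergenceFree u ∧ ∀ T : ℝ, T₀ ≤ T → nonuniquenessSet u T = univ := by
  have hd : 3 ≤ d := by
    have hd' : (2 : ℝ) < d := by linarith
    exact_mod_cast hd'
  obtain ⟨n, rfl⟩ := Nat.exists_eq_add_of_le' hd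
  obtain ⟨N, η, hN, hη, hηN, hal, hlr⟩ := exists_parameters n (p := p) (α := α)
    (by push_cast at hpd; linarith) (by exact_mod_cast hα₁)
  have hηN' : η * N ≤ 1 := by linarith
  exact ⟨steadyField n N η (2 / T₀), memSobolev_steadyField hN hη hηN' hp hlr _,
    memHolder_steadyField hN hη hηN' hα₁.le hal _, isDivergenceFree_steadyField hN hη hηN' hp hlr _,
    fun T hT => nonuniquenessSet_steadyField hN hη hηN (by positivity)
      (by rwa [div_div_cancel₀ two_ne_zero])⟩

theorem theorem2 (d : ℕ) (hd : 3 ≤ d) (p : ℝ) (hp : 1 ≤ p) (hpd : p < (d : ℝ) - 1)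
    (α : ℝ≥0) (hα₀ : 0 < α) (hα₁ : α < 1) (T₀ : ℝ) (hT₀ : 0 < T₀) :
    ∃ u : SteadyFlow.Torus d → SteadyFlow.Space d,
      SteadyFlow.MemSobolev (ENNReal.ofReal p) u ∧
      MemHolder α u ∧
      SteadyFlow.IsDivergenceFree u ∧
      ∀ T : ℝ, T₀ ≤ T → ∀ᵐ x : SteadyFlow.Torus d, x ∈ SteadyFlow.nonuniquenessSet u T := by
  obtain ⟨u, hsobolev, hholder, hdiv, huniv⟩ := theorem2_general hp hpd hα₁ hT₀
  exact ⟨u, hsobolev, hholder, hdiv, fun T hT => by simp [huniv T hT]⟩
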